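/- Let $d\ge 1$ be an integer, $\alpha\in(0,2)$, and let $f$ be a symmetric probability density on $\mathbb{R}^d$ ($f(-x)=f(x)$) for which there are constants $C_1,C_2>0$ with $$C_1\,(\|x\|_2\vee 1)^{-d-\alpha}\le f(x)\le C_2\,(\|x\|_2\vee 1)^{-d-\alpha}\qquad\text{for all }x\in\mathbb{R}^d .$$ For an integer $L\ge 2$ let $\Lambda_{L,d}=\big((-\tfrac L2,\tfrac L2]\cap\mathbb{Z}\big)^d$, regarded as the discrete torus $(\mathbb{Z}/L\mathbb{Z})^d$, let $N=L^d$ be its number of points, let $[x]_L\in\Lambda_{L,d}$ be the canonical representative of $x$ modulo $L$, and let $\|x\|_2$ denote the Euclidean norm of $[x]_L$. For $W>0$ let $p_n(x)$ be the $n$-step transition probability from $0$ to $x$ of the Markov chain on $\Lambda_{L,d}$ with one-step transition probabilities $$p_1(x,y)=\frac{1}{\Omega_W}f\Big(\frac{[y-x]_L}{W}\Big)\quad (x\ne y),\qquad p_1(x,x)=0,\qquad \Omega_W=\sum_{0\ne x\in\Lambda_{L,d}}f\Big(\frac{x}{W}\Big).$$ Then for every $W_0>0$ there is a constant $C>0$,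 depending only on $d,\alpha,f,W_0$, such that for all integers $L\ge 2$, all real $W\ge W_0$, all integers $n\ge 1$ and all $x\in\Lambda_{L,d}$, $$p_n(x)\le C\left(\Big(\frac{1}{n^{d/\alpha}W^d}\wedge\frac{nW^{\alpha}}{(\|x\|_2\vee W)^{d+\alpha}}\Big)+\frac1N\right).$$ -/

import Mathlib

noncomputable section

namespace CirculantWalk

/-- The discrete torus with side `L` in dimension `d`. Its points are in bijection, through
`rep`, with the integer vectors in the box `(-L/2, L/2]^d`. -/
abbrev Torus (d L : ℕ) : Type := Fin d → ZMod L

/-- The canonical representative `[x]_L`, seen as a vector of the Euclidean space `ℝ^d`. -/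
def rep {d L : ℕ} (x : Torus d L) : EuclideanSpace ℝ (Fin d) :=
  WithLp.toLp 2 fun i => ((x i).valMinAbs : ℝ)

/-- The coordinates of `rep` are the integers congruent to those of `x` in `(-L/2, L/2]`. -/
theorem rep_spec {d L : ℕ} [NeZero L] (x : Torus d L) (i : Fin d) (m : ℤ) :
    rep x i = (m : ℝ) ↔ x i = (m : ZMod L) ∧ -(L : ℝ) / 2 < m ∧ (m : ℝ) ≤ (L : ℝ) / 2 := by
  have h1 : rep x i = ((x i).valMinAbs : ℝ) := rfl
  rw [h1, Int.cast_inj, ZMod.valMinAbs_spec, Set.mem_Ioc]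
  refine and_congr_right fun _ => and_congr ?_ ?_
  · rw [div_lt_iff₀ two_pos]
    exact_mod_cast Iff.rfl
  · rw [le_div_iff₀ two_pos]
    exact_mod_cast Iff.rfl

/-- The periodic Euclidean norm on the torus: the `ℓ²` norm of the canonical representative. -/
def torusNorm {d L : ℕ} (x : Torus d L) : ℝ := ‖rep x‖

/-- `f` is a symmetric probability density on `ℝ^d`. -/
structure IsSymmetricDensity {d : ℕ} (f : EuclideanSpace ℝ (Fin d) → ℝ) : Prop where
  nonneg : ∀ x, 0 ≤ f x
  integrable : MeasureTheory.Integrable f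
  integral_eq_one : ∫ x, f x = 1
  symm : ∀ x, f (-x) = f x

/-- `f ≍ g`: two-sided comparison on the whole space with positive constants. -/
def Comparable {E : Type*} (f g : E → ℝ) : Prop :=
  ∃ C₁ C₂ : ℝ, 0 < C₁ ∧ 0 < C₂ ∧ ∀ x, C₁ * g x ≤ f x ∧ f x ≤ C₂ * g x

/-- The normalization `Ω_W`, the sum of `f (x / W)` over the nonzero points of the torus. -/
def Omega {d : ℕ} (L : ℕ) [NeZero L] (W : ℝ) (f : EuclideanSpace ℝ (Fin d) → ℝ) : ℝ :=
  ∑ x : Torus d L with x ≠ 0, f (W⁻¹ • rep x)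

/-- One-step transition matrix of the circulant random walk with profile `f` and bandwidth `W`.
The off-diagonal entries of each row add up to one, so the diagonal is zero. -/
def transition {d : ℕ} (L : ℕ) [NeZero L] (W : ℝ) (f : EuclideanSpace ℝ (Fin d) → ℝ) :
    Matrix (Torus d L) (Torus d L) ℝ :=
  Matrix.of fun x y => if x = y then 0 else f (W⁻¹ • rep (y - x)) / Omega L W f

/-- The `n`-step transition probability `p_n(x) = p_n(0, x)`. -/
def stepProb {d : ℕ} (L : ℕ) [NeZero L] (W : ℝ) (f : EuclideanSpace ℝ (Fin d) → ℝ)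
    (n : ℕ) (x : Torus d L) : ℝ :=
  (transition L W f ^ n) 0 x

end CirculantWalk

end

/-!
The chain is a circulant walk, so `p_n` is the `n`-fold convolution power of its one-step law. Off
the origin that law is comparable with the stable profile `V ^ α / (‖x‖ ∨ V) ^ (d + α)` at the
scale `V = W ∧ L`; write `T = n V ^ α` and let `E_n` be the sum of the squares of `p_n`.

*On the diagonal.* A step charges every point of a ball of radius `ρ` with mass at least of order
`V ^ α / ρ ^ (d + α)`, so `E_n` decreases by that mass times the variation of `p_n` over such balls.
Balls with `2 / E_n` points give `E_{n+1} ≤ E_n (1 - κ V ^ α E_n ^ (α / d))` until `E_n` is of order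
`1 / N`. Hence `E_n ≲ T ^ (-d / α) + 1 / N`, and `p_{j+k} ≤ (E_j + E_k) / 2`.

*Off the diagonal.* Let `ρ` be a small multiple of `‖x‖ ∨ V`; when `ρ ^ α ≤ T` the previous bound
suffices. Otherwise forbid jumps longer than `ρ`: the paths that make one contribute `n` times the
profile. The truncated walk is even and has bounded exponential moments, so a Chernoff bound gives
it probability at most a constant times `(T / ρ ^ α) ^ (1 + d / α)` of leaving a ball whose radius
is a multiple of `ρ`. A walk at `x` at time `j + k` went far before or after time `j`, and the other
part is bounded by the on-diagonal estimate.
-/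

namespace CirculantWalk

open Finset

section ConvolutionPower

variable {G R : Type*} [AddCommGroup G] [Fintype G]

theorem sum_sub_left_eq [AddCommMonoid R] (g : G → R) (x : G) : ∑ y, g (x - y) = ∑ y, g y :=
  (Equiv.subLeft x).sum_comp g

theorem sum_sub_right_eq [AddCommMonoid R] (g : G → R) (y : G) : ∑ x, g (x - y) = ∑ x, g x :=
  (Equiv.subRight y).sum_comp g

variable [DecidableEq G]

/-- The `n`-fold convolution power of a function on a finite abelian group, encoded as the zeroth
column of the `n`-th power of its circulant matrix. -/
def convPow [CommSemiring R] (p : G → R) (n : ℕ) (x : G) : R :=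
  (Matrix.circulant p ^ n) x 0

section CommSemiring

variable [CommSemiring R]

theorem circulant_pow (p : G → R) (n : ℕ) :
    Matrix.circulant p ^ n = Matrix.circulant (convPow p n) := by
  obtain ⟨v, hv⟩ : ∃ v, Matrix.circulant p ^ n = Matrix.circulant v := by
    induction n with
    | zero => exact ⟨Pi.single 0 1, by rw [pow_zero, Matrix.circulant_single_one]⟩
    | succ n ih =>
      obtain ⟨v, hv⟩ := ih
      exact ⟨_, by rw [pow_succ, hv, Matrix.circulant_mul]⟩
  rw [hv]
  congr
  funext x
  rw [convPow, hv, Matrix.circulant_col_zero_eq]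

theorem convPow_zero (p : G → R) : convPow p 0 = Pi.single 0 1 := by
  funext x
  rw [convPow, pow_zero, Matrix.one_apply, Pi.single_apply]

theorem convPow_one (p : G → R) : convPow p 1 = p := by
  funext x
  rw [convPow, pow_one, Matrix.circulant_col_zero_eq]

theorem convPow_add (p : G → R) (m n : ℕ) (x : G) :
    convPow p (m + n) x = ∑ y, convPow p m y * convPow p n (x - y) := by
  rw [← sum_sub_left_eq _ x, convPow, pow_add, Matrix.mul_apply]
  simp only [circulant_pow, Matrix.circulant_apply, sub_zero, sub_sub_cancel]

theorem convPow_succ (p : G → R) (n : ℕ) (x : G) :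
    convPow p (n + 1) x = ∑ y, p y * convPow p n (x - y) := by
  rw [add_comm, convPow_add, convPow_one]

theorem sum_convPow (p : G → R) (n : ℕ) : ∑ x, convPow p n x = (∑ x, p x) ^ n := by
  induction n with
  | zero => simp [convPow_zero]
  | succ n ih =>
    simp_rw [convPow_succ]
    rw [sum_comm]
    simp_rw [← mul_sum, sum_sub_right_eq, ih]
    rw [← sum_mul, pow_succ']

end CommSemiring

section IsOrderedRing

variable [CommSemiring R] [PartialOrder R] [IsOrderedRing R] {a p : G → R}

theorem convPow_nonneg (hp : ∀ x, 0 ≤ p x) (n : ℕ) (x : G) : 0 ≤ convPow p n x := by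
  induction n generalizing x with
  | zero =>
    rw [convPow_zero]
    have hsingle : (0 : G → R) ≤ Pi.single 0 1 := Pi.single_nonneg.2 zero_le_one
    exact hsingle x
  | succ n ih => rw [convPow_succ]; exact sum_nonneg fun y _ => mul_nonneg (hp y) (ih _)

theorem convPow_mono (ha : ∀ x, 0 ≤ a x) (hap : ∀ x, a x ≤ p x) (n : ℕ) (x : G) :
    convPow a n x ≤ convPow p n x := by
  induction n generalizing x with
  | zero => rw [convPow_zero, convPow_zero]
  | succ n ih =>
    rw [convPow_succ, convPow_succ]
    exact sum_le_sum fun y _ => mul_le_mul (hap y) (ih _) (convPow_nonneg ha _ _)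
      ((ha y).trans (hap y))

theorem convPow_mem_stdSimplex (hp : p ∈ stdSimplex R G) (n : ℕ) : convPow p n ∈ stdSimplex R G :=
  ⟨convPow_nonneg hp.1 n, by rw [sum_convPow, hp.2, one_pow]⟩

theorem convPow_succ_le_of_forall_le (hp : p ∈ stdSimplex R G) {M : R} (hM : ∀ x, p x ≤ M) (n : ℕ)
    (x : G) : convPow p (n + 1) x ≤ M :=
  calc convPow p (n + 1) x = ∑ y, p y * convPow p n (x - y) := convPow_succ p n x
    _ ≤ ∑ y, M * convPow p n (x - y) :=
        sum_le_sum fun y _ => mul_le_mul_of_nonneg_right (hM y) (convPow_nonneg hp.1 _ _)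
    _ = M := by rw [← mul_sum, sum_sub_left_eq, (convPow_mem_stdSimplex hp n).2, mul_one]

theorem convPow_le_add_of_le_add (ha : ∀ x, 0 ≤ a x) (hap : ∀ x, a x ≤ p x)
    (hp : p ∈ stdSimplex R G) {β : R} (hβ₀ : 0 ≤ β) (hβ : ∀ x, p x ≤ a x + β) (n : ℕ) (x : G) :
    convPow p n x ≤ convPow a n x + n * β := by
  have hmass : ∑ y, a y ≤ 1 := hp.2 ▸ sum_le_sum fun y _ => hap y
  induction n generalizing x with
  | zero => simp [convPow_zero]
  | succ n ih =>
    calc convPow p (n + 1) x = ∑ y, p y * convPow p n (x - y) := convPow_succ p n x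
      _ ≤ ∑ y, (a y * convPow a n (x - y) + a y * (n * β) + β * convPow p n (x - y)) := by
          refine sum_le_sum fun y _ => ?_
          rw [← mul_add]
          refine (mul_le_mul_of_nonneg_right (hβ y) (convPow_nonneg hp.1 n _)).trans ?_
          rw [add_mul]
          gcongr
          · exact ha y
          · exact ih _
      _ = convPow a (n + 1) x + (∑ y, a y) * (n * β) + β := by
          rw [sum_add_distrib, sum_add_distrib, ← convPow_succ, ← sum_mul, ← mul_sum,
            sum_sub_left_eq, (convPow_mem_stdSimplex hp n).2, mul_one]
      _ ≤ convPow a (n + 1) x + 1 * (n * β) + β := by gcongr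
      _ = convPow a (n + 1) x + (n + 1 : ℕ) * β := by push_cast; ring

theorem sum_convPow_mul_le {w : G → R} {M : R} (ha : ∀ x, 0 ≤ a x) (hM : 0 ≤ M) (hw₀ : w 0 = 1)
    (hw : ∀ x, ∑ y, a y * w (y + x) ≤ M * w x) (n : ℕ) :
    ∑ x, convPow a n x * w x ≤ M ^ n := by
  induction n with
  | zero => simp [convPow_zero, Pi.single_apply, hw₀]
  | succ n ih =>
    calc ∑ x, convPow a (n + 1) x * w x
        = ∑ y, ∑ x, a y * convPow a n (x - y) * w x := by
          simp only [convPow_succ, sum_mul]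
          exact sum_comm
      _ = ∑ y, ∑ x, a y * convPow a n x * w (y + x) := by
          refine sum_congr rfl fun y _ => ?_
          rw [← Equiv.sum_comp (Equiv.addLeft y) fun x => a y * convPow a n (x - y) * w x]
          simp only [Equiv.coe_addLeft, add_sub_cancel_left]
      _ = ∑ x, convPow a n x * ∑ y, a y * w (y + x) := by
          rw [sum_comm]
          simp only [mul_sum, mul_assoc, mul_left_comm]
      _ ≤ ∑ x, convPow a n x * (M * w x) :=
          sum_le_sum fun x _ => mul_le_mul_of_nonneg_left (hw x) (convPow_nonneg ha _ _)
      _ = M * ∑ x, convPow a n x * w x := by simp only [mul_sum, mul_left_comm]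
      _ ≤ M ^ (n + 1) := by
          rw [pow_succ']
          exact mul_le_mul_of_nonneg_left ih hM

end IsOrderedRing

theorem convPow_add_le_of_tail_le {a h : G → ℝ} (ha : ∀ x, 0 ≤ a x)
    (hadd : ∀ y z, h (y + z) ≤ h y + h z) {m n : ℕ} {S τ s : ℝ}
    (hm : ∀ y, convPow a m y ≤ S) (hn : ∀ y, convPow a n y ≤ S)
    (hm_tail : ∑ y with s ≤ h y, convPow a m y ≤ τ) (hn_tail : ∑ y with s ≤ h y, convPow a n y ≤ τ)
    {x : G} (hx : 2 * s ≤ h x) : convPow a (m + n) x ≤ 2 * S * τ := by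
  have hS : 0 ≤ S := (convPow_nonneg ha m 0).trans (hm 0)
  have hsplit (y : G) : convPow a m y * convPow a n (x - y) ≤
      S * (if s ≤ h y then convPow a m y else 0) +
        S * (if s ≤ h (x - y) then convPow a n (x - y) else 0) := by
    have hm₀ := convPow_nonneg ha m y
    have hn₀ := convPow_nonneg ha n (x - y)
    by_cases hy : s ≤ h y
    · have hrest : 0 ≤ S * (if s ≤ h (x - y) then convPow a n (x - y) else 0) := by positivity
      rw [if_pos hy]
      nlinarith [mul_le_mul_of_nonneg_left (hn (x - y)) hm₀]
    · have hxy : s ≤ h (x - y) := by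
        have := hadd y (x - y)
        rw [add_sub_cancel] at this
        linarith
      rw [if_neg hy, if_pos hxy, mul_zero, zero_add]
      exact mul_le_mul_of_nonneg_right (hm y) hn₀
  calc convPow a (m + n) x
      ≤ S * ∑ y with s ≤ h y, convPow a m y + S * ∑ y with s ≤ h y, convPow a n y := by
        rw [convPow_add, sum_filter, sum_filter,
          ← sum_sub_left_eq (fun y => if s ≤ h y then convPow a n y else 0) x, mul_sum, mul_sum,
          ← sum_add_distrib]
        exact sum_le_sum fun y _ => hsplit y
    _ ≤ S * τ + S * τ := by gcongr
    _ = 2 * S * τ := by ring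

end ConvolutionPower

section Energy

theorem sq_sum_mul_le_sub {ι : Type*} [Fintype ι] {p : ι → ℝ} (hp : p ∈ stdSimplex ℝ ι)
    {B : Finset ι} {β : ℝ} (hβ : 0 ≤ β) (hpB : ∀ i ∈ B, β ≤ p i) (g : ι → ℝ) :
    (∑ i, p i * g i) ^ 2 ≤
      ∑ i, p i * g i ^ 2 - β * (∑ i ∈ B, g i ^ 2 - (∑ i ∈ B, g i) ^ 2 / #B) := by
  set m := ∑ i, p i * g i with hm
  have hvar : ∑ i, p i * (g i - m) ^ 2 = ∑ i, p i * g i ^ 2 - m ^ 2 := by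
    have hexpand (c : ℝ) : ∑ i, p i * (g i - c) ^ 2 =
        ∑ i, p i * g i ^ 2 - 2 * c * ∑ i, p i * g i + c ^ 2 * ∑ i, p i := by
      rw [mul_sum, mul_sum, ← sum_sub_distrib, ← sum_add_distrib]
      exact sum_congr rfl fun i _ => by ring
    rw [hexpand, hp.2, ← hm]
    ring
  have hle : β * ∑ i ∈ B, (g i - m) ^ 2 ≤ ∑ i, p i * (g i - m) ^ 2 := by
    rw [mul_sum]
    exact (sum_le_sum fun i hi => mul_le_mul_of_nonneg_right (hpB i hi) (sq_nonneg _)).trans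
      (sum_le_univ_sum_of_nonneg fun i => mul_nonneg (hp.1 i) (sq_nonneg _))
  have hmin : ∑ i ∈ B, g i ^ 2 - (∑ i ∈ B, g i) ^ 2 / #B ≤ ∑ i ∈ B, (g i - m) ^ 2 := by
    have hexpand : ∑ i ∈ B, (g i - m) ^ 2 =
        ∑ i ∈ B, g i ^ 2 - 2 * m * ∑ i ∈ B, g i + #B * m ^ 2 := by
      rw [mul_sum, ← nsmul_eq_mul, ← sum_const, ← sum_sub_distrib, ← sum_add_distrib]
      exact sum_congr rfl fun i _ => by ring
    rcases B.eq_empty_or_nonempty with rfl | hB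
    · simp
    · have hB₀ : (0 : ℝ) < #B := by exact_mod_cast hB.card_pos
      have hsq : 0 ≤ (∑ i ∈ B, g i - #B * m) ^ 2 / #B := by positivity
      rw [hexpand]
      field_simp at hsq ⊢
      linarith
  linarith [mul_le_mul_of_nonneg_left hmin hβ]

variable {G : Type*} [AddCommGroup G] [Fintype G]

theorem sum_sq_conv_le {p μ : G → ℝ} (hp : p ∈ stdSimplex ℝ G) (hμ : μ ∈ stdSimplex ℝ G)
    {B : Finset G} {β : ℝ} (hβ : 0 ≤ β) (hpB : ∀ x ∈ B, β ≤ p x) :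
    ∑ x, (∑ y, p y * μ (x - y)) ^ 2 ≤ (1 - β * #B) * ∑ x, μ x ^ 2 + β := by
  have hcross : ∑ x, (∑ y ∈ B, μ (x - y)) ^ 2 / #B ≤ 1 := by
    have hmass (x : G) : ∑ y ∈ B, μ (x - y) ≤ 1 := by
      rw [← hμ.2, ← sum_sub_left_eq μ x]
      exact sum_le_univ_sum_of_nonneg fun y => hμ.1 _
    calc ∑ x, (∑ y ∈ B, μ (x - y)) ^ 2 / #B ≤ ∑ x, (∑ y ∈ B, μ (x - y)) / #B :=
          sum_le_sum fun x _ => div_le_div_of_nonneg_right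
            (pow_le_of_le_one (sum_nonneg fun y _ => hμ.1 _) (hmass x) two_ne_zero)
            (Nat.cast_nonneg _)
      _ = #B / #B := by
          rw [← sum_div, sum_comm]
          simp only [sum_sub_right_eq, hμ.2, sum_const, nsmul_eq_mul, mul_one]
      _ ≤ 1 := div_self_le_one _
  calc ∑ x, (∑ y, p y * μ (x - y)) ^ 2
      ≤ ∑ x, (∑ y, p y * μ (x - y) ^ 2 -
          β * (∑ y ∈ B, μ (x - y) ^ 2 - (∑ y ∈ B, μ (x - y)) ^ 2 / #B)) :=
        sum_le_sum fun x _ => sq_sum_mul_le_sub hp hβ hpB fun y => μ (x - y)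
    _ = ∑ x, μ x ^ 2 -
          β * (#B * ∑ x, μ x ^ 2 - ∑ x, (∑ y ∈ B, μ (x - y)) ^ 2 / #B) := by
        rw [sum_sub_distrib, ← mul_sum, sum_sub_distrib, sum_comm,
          sum_comm (s := univ) (t := B)]
        simp_rw [← mul_sum, sum_sub_right_eq (fun x => μ x ^ 2)]
        rw [← sum_mul, hp.2, one_mul, sum_const, nsmul_eq_mul]
    _ ≤ (1 - β * #B) * ∑ x, μ x ^ 2 + β := by
        linarith [mul_le_mul_of_nonneg_left hcross hβ]

variable [DecidableEq G] {p : G → ℝ}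

/-- The energy of a random walk at time `n`: the square of the `ℓ²` norm of its law. For an even
step law `p` it is the return probability at time `2 * n`. -/
def energy (p : G → ℝ) (n : ℕ) : ℝ :=
  ∑ x, convPow p n x ^ 2

theorem energy_pos (hp : p ∈ stdSimplex ℝ G) (n : ℕ) : 0 < energy p n := by
  refine (sum_nonneg fun x _ => sq_nonneg _).lt_of_ne fun h => ?_
  have hzero := (sum_eq_zero_iff_of_nonneg fun x _ => sq_nonneg (convPow p n x)).1 h.symm
  have hone := (convPow_mem_stdSimplex hp n).2
  simp only [mem_univ, forall_const, sq_eq_zero_iff] at hzero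
  simp [hzero] at hone

theorem energy_le_of_convPow_le (hp : p ∈ stdSimplex ℝ G) {n : ℕ} {M : ℝ}
    (hM : ∀ x, convPow p n x ≤ M) : energy p n ≤ M :=
  calc energy p n ≤ ∑ x, M * convPow p n x := sum_le_sum fun x _ => by
        rw [sq]
        exact mul_le_mul_of_nonneg_right (hM x) (convPow_nonneg hp.1 n x)
    _ = M := by rw [← mul_sum, (convPow_mem_stdSimplex hp n).2, mul_one]

theorem energy_le_one (hp : p ∈ stdSimplex ℝ G) (n : ℕ) : energy p n ≤ 1 := by
  have hpn := convPow_mem_stdSimplex hp n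
  exact energy_le_of_convPow_le hp fun x =>
    hpn.2 ▸ single_le_sum (fun y _ => hpn.1 y) (mem_univ x)

theorem energy_succ_le_of_forall_mem_le (hp : p ∈ stdSimplex ℝ G) {B : Finset G} {β : ℝ}
    (hβ : 0 ≤ β) (hpB : ∀ x ∈ B, β ≤ p x) (n : ℕ) :
    energy p (n + 1) ≤ (1 - β * #B) * energy p n + β := by
  simp only [energy, convPow_succ]
  exact sum_sq_conv_le hp (convPow_mem_stdSimplex hp n) hβ hpB

theorem energy_antitone (hp : p ∈ stdSimplex ℝ G) : Antitone (energy p) :=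
  antitone_nat_of_succ_le fun n => by
    simpa using energy_succ_le_of_forall_mem_le hp le_rfl (B := ∅) (by simp) n

theorem convPow_add_le_energy (p : G → ℝ) (m n : ℕ) (x : G) :
    convPow p (m + n) x ≤ (energy p m + energy p n) / 2 := by
  rw [energy, energy, convPow_add, ← sum_sub_left_eq (fun y => convPow p n y ^ 2) x,
    ← sum_add_distrib, sum_div]
  refine sum_le_sum fun y _ => ?_
  linarith [two_mul_le_add_sq (convPow p m y) (convPow p n (x - y))]

end Energy

section Recursion

theorem rpow_neg_add_le_rpow_neg {e e' γ κ : ℝ} (hγ : 0 ≤ γ) (he : 0 < e) (he' : 0 < e')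
    (hstep : e' ≤ e * (1 - κ * e ^ γ)) : e ^ (-γ) + γ * κ ≤ e' ^ (-γ) := by
  have hexp : e' ≤ e * Real.exp (-(κ * e ^ γ)) :=
    hstep.trans (by gcongr; exact Real.one_sub_le_exp_neg _)
  have hcancel : e ^ (-γ) * e ^ γ = 1 := by rw [← Real.rpow_add he, neg_add_cancel, Real.rpow_zero]
  calc e ^ (-γ) + γ * κ = e ^ (-γ) * (1 + γ * (κ * e ^ γ)) := by
        linear_combination -γ * κ * hcancel
    _ ≤ e ^ (-γ) * Real.exp (γ * (κ * e ^ γ)) := by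
        gcongr
        linarith [Real.add_one_le_exp (γ * (κ * e ^ γ))]
    _ = (e * Real.exp (-(κ * e ^ γ))) ^ (-γ) := by
        rw [Real.mul_rpow he.le (Real.exp_pos _).le, ← Real.exp_mul]
        ring_nf
    _ ≤ e' ^ (-γ) := Real.rpow_le_rpow_of_nonpos he' hexp (neg_nonpos.2 hγ)

theorem le_or_mul_le_rpow_neg {e : ℕ → ℝ} {γ κ c E : ℝ} (hγ : 0 ≤ γ) (hpos : ∀ n, 0 < e n)
    (hanti : Antitone e) (hcκ : c ≤ γ * κ) (hc : c ≤ e 1 ^ (-γ))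
    (hstep : ∀ n, 1 ≤ n → E ≤ e n → e (n + 1) ≤ e n * (1 - κ * e n ^ γ)) {n : ℕ} (hn : 1 ≤ n) :
    e n ≤ E ∨ c * n ≤ e n ^ (-γ) := by
  induction n, hn using Nat.le_induction with
  | base => right; simpa using hc
  | succ n hn ih =>
    rcases le_or_gt (e n) E with hle | hlt
    · exact .inl ((hanti n.le_succ).trans hle)
    · right
      have hgrow := rpow_neg_add_le_rpow_neg hγ (hpos n) (hpos (n + 1)) (hstep n hn hlt.le)
      have hprev := ih.resolve_left hlt.not_ge
      push_cast
      linarith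

theorem le_of_dyadic_recursion {F : ℝ → ℝ} {A s ε : ℝ} (hs : 0 < s) (hA : 0 ≤ A) (hε : 0 < ε)
    (hsmall : ∀ r, 0 < r → r < ε → F r ≤ 0) (hrec : ∀ r, 0 < r → F r ≤ F (r / 2) + A * r ^ s)
    {r : ℝ} (hr : 0 < r) : F r ≤ A / (1 - 2 ^ (-s)) * r ^ s := by
  have hgap : 0 < 1 - (2 : ℝ) ^ (-s) :=
    sub_pos.2 (Real.rpow_lt_one_of_one_lt_of_neg one_lt_two (neg_lt_zero.2 hs))
  obtain ⟨n, hn⟩ := pow_unbounded_of_one_lt (r / ε) one_lt_two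
  rw [div_lt_iff₀ hε] at hn
  induction n generalizing r with
  | zero => exact (hsmall r hr (by simpa using hn)).trans (by positivity)
  | succ n ih =>
    have hhalf := ih (half_pos hr) (by rw [pow_succ] at hn; linarith)
    calc F r ≤ A / (1 - 2 ^ (-s)) * (r / 2) ^ s + A * r ^ s := by linarith [hrec r hr]
      _ = A / (1 - 2 ^ (-s)) * r ^ s := by
          have hpow : (r / 2) ^ s = 2 ^ (-s) * r ^ s := by
            rw [Real.div_rpow hr.le two_pos.le, Real.rpow_neg two_pos.le, inv_mul_eq_div]
          rw [hpow]
          field_simp [hgap.ne']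
          ring

end Recursion

section DyadicSums

variable {ι : Type*} {s : Finset ι} {N : ι → ℝ} {K b q : ℝ}

theorem sum_shell_rpow_le (hcard : ∀ r, 0 < r → (#{i ∈ s | N i ≤ r} : ℝ) ≤ K * r ^ b) (q : ℝ)
    {r : ℝ} (hr : 0 < r) :
    ∑ i ∈ s with r / 2 < N i ∧ N i ≤ r, N i ^ q ≤ K * 2 ^ |q| * r ^ (b + q) := by
  have hterm {t : ℝ} (hlt : r / 2 < t) (hle : t ≤ r) : t ^ q ≤ 2 ^ |q| * r ^ q := by
    have ht : 0 < t := (half_pos hr).trans hlt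
    rcases le_or_gt 0 q with hq | hq
    · rw [abs_of_nonneg hq]
      exact (Real.rpow_le_rpow ht.le hle hq).trans
        (le_mul_of_one_le_left (by positivity) (Real.one_le_rpow one_le_two hq))
    · refine (Real.rpow_le_rpow_of_nonpos (half_pos hr) hlt.le hq.le).trans_eq ?_
      rw [abs_of_neg hq, Real.div_rpow hr.le two_pos.le, Real.rpow_neg two_pos.le]
      ring
  have hshell : (#{i ∈ s | r / 2 < N i ∧ N i ≤ r} : ℝ) ≤ K * r ^ b :=
    (Nat.cast_le.2 (card_le_card (monotone_filter_right s fun _ _ => And.right))).trans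
      (hcard r hr)
  calc ∑ i ∈ s with r / 2 < N i ∧ N i ≤ r, N i ^ q
      ≤ #{i ∈ s | r / 2 < N i ∧ N i ≤ r} * (2 ^ |q| * r ^ q) := by
        rw [← nsmul_eq_mul]
        exact sum_le_card_nsmul _ _ _ fun i hi => hterm (mem_filter.1 hi).2.1 (mem_filter.1 hi).2.2
    _ ≤ K * r ^ b * (2 ^ |q| * r ^ q) := by gcongr
    _ = K * 2 ^ |q| * r ^ (b + q) := by rw [Real.rpow_add hr]; ring

theorem sum_rpow_le_of_le (hN : ∀ i ∈ s, 0 < N i)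
    (hcard : ∀ r, 0 < r → (#{i ∈ s | N i ≤ r} : ℝ) ≤ K * r ^ b) (hbq : 0 < b + q)
    {r : ℝ} (hr : 0 < r) :
    ∑ i ∈ s with N i ≤ r, N i ^ q ≤ K * 2 ^ |q| / (1 - 2 ^ (-(b + q))) * r ^ (b + q) := by
  have hK : 0 ≤ K := by simpa using (Nat.cast_nonneg _).trans (hcard 1 one_pos)
  obtain ⟨ε, hε, hεN⟩ : ∃ ε > 0, ∀ i ∈ s, ε ≤ N i := by
    rcases s.eq_empty_or_nonempty with rfl | hs
    · exact ⟨1, one_pos, by simp⟩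
    · obtain ⟨i, hi, hmin⟩ := s.exists_min_image N hs
      exact ⟨N i, hN i hi, hmin⟩
  refine le_of_dyadic_recursion (F := fun r => ∑ i ∈ s with N i ≤ r, N i ^ q) hbq (by positivity) hε
    (fun r _ hrε => ?_) (fun r hr => ?_) hr
  · rw [filter_false_of_mem fun i hi => (hrε.trans_le (hεN i hi)).not_ge, sum_empty]
  · have hsplit : ∑ i ∈ s with N i ≤ r, N i ^ q = ∑ i ∈ s with N i ≤ r / 2, N i ^ q +
        ∑ i ∈ s with r / 2 < N i ∧ N i ≤ r, N i ^ q := by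
      rw [← sum_filter_add_sum_filter_not {i ∈ s | N i ≤ r} (fun i => N i ≤ r / 2),
        filter_filter, filter_filter]
      congr 2 <;> grind
    rw [hsplit]
    gcongr
    exact sum_shell_rpow_le hcard q hr

theorem sum_rpow_le_of_lt (hN : ∀ i ∈ s, 0 < N i)
    (hcard : ∀ r, 0 < r → (#{i ∈ s | N i ≤ r} : ℝ) ≤ K * r ^ b) (hbq : b + q < 0)
    {r : ℝ} (hr : 0 < r) :
    ∑ i ∈ s with r < N i, N i ^ q ≤
      K * 2 ^ |q| * 2 ^ (b + q) / (1 - 2 ^ (b + q)) * r ^ (b + q) := by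
  have hK : 0 ≤ K := by simpa using (Nat.cast_nonneg _).trans (hcard 1 one_pos)
  have hM : 0 < 1 + ∑ i ∈ s, N i := by linarith [sum_nonneg fun i hi => (hN i hi).le]
  -- The tail sums satisfy the dyadic recursion in the inverse variable `t = r⁻¹`.
  have htail := le_of_dyadic_recursion (F := fun t => ∑ i ∈ s with t⁻¹ < N i, N i ^ q)
    (A := K * 2 ^ |q| * 2 ^ (b + q)) (neg_pos.2 hbq) (by positivity) (inv_pos.2 hM)
    (fun t ht htM => ?_) (fun t ht => ?_) (inv_pos.2 hr)
  · rwa [inv_inv, neg_neg, Real.inv_rpow hr.le, Real.rpow_neg hr.le, inv_inv] at htail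
  · rw [filter_false_of_mem fun i hi => ?_, sum_empty]
    have hle := single_le_sum (fun j hj => (hN j hj).le) hi
    linarith [(lt_inv_comm₀ ht hM).1 htM]
  · have hsplit : ∑ i ∈ s with t⁻¹ < N i, N i ^ q = ∑ i ∈ s with (t / 2)⁻¹ < N i, N i ^ q +
        ∑ i ∈ s with 2 * t⁻¹ / 2 < N i ∧ N i ≤ 2 * t⁻¹, N i ^ q := by
      have htwo : (t / 2)⁻¹ = 2 * t⁻¹ := by rw [inv_div, div_eq_mul_inv]
      have ht' : t⁻¹ ≤ 2 * t⁻¹ := by linarith [inv_pos.2 ht]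
      rw [htwo, mul_div_cancel_left₀ _ two_ne_zero,
        ← sum_filter_add_sum_filter_not {i ∈ s | t⁻¹ < N i} (fun i => 2 * t⁻¹ < N i),
        filter_filter, filter_filter]
      congr 2 <;> grind
    rw [hsplit]
    gcongr
    refine (sum_shell_rpow_le hcard q (by positivity)).trans_eq ?_
    rw [Real.mul_rpow two_pos.le (by positivity), Real.inv_rpow ht.le, ← Real.rpow_neg ht.le]
    ring

end DyadicSums

section TorusNorm

variable {d L : ℕ}

theorem rep_apply (x : Torus d L) (i : Fin d) : rep x i = ((x i).valMinAbs : ℝ) := rfl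

theorem rep_zero : rep (0 : Torus d L) = 0 := by
  ext i
  simp [rep_apply]

theorem abs_rep_apply (x : Torus d L) (i : Fin d) : |rep x i| = (x i).valMinAbs.natAbs := by
  rw [rep_apply, Nat.cast_natAbs, Int.cast_abs]

theorem abs_rep_add_apply_le (x y : Torus d L) (i : Fin d) :
    |rep (x + y) i| ≤ |rep x i + rep y i| := by
  have hle := ZMod.natAbs_valMinAbs_add_le (x i) (y i)
  rw [abs_rep_apply, rep_apply, rep_apply, ← Int.cast_add, ← Int.cast_abs, ← Nat.cast_natAbs,
    Nat.cast_le]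
  exact hle

theorem abs_rep_apply_le_torusNorm (x : Torus d L) (i : Fin d) : |rep x i| ≤ torusNorm x :=
  PiLp.norm_apply_le (rep x) i

theorem torusNorm_le_sqrt_mul {x : Torus d L} {r : ℝ} (hr : 0 ≤ r) (hx : ∀ i, |rep x i| ≤ r) :
    torusNorm x ≤ √d * r := by
  rw [torusNorm, EuclideanSpace.norm_eq, Real.sqrt_le_iff, mul_pow, Real.sq_sqrt d.cast_nonneg]
  refine ⟨by positivity, ?_⟩
  calc ∑ i, ‖rep x i‖ ^ 2 ≤ ∑ _i : Fin d, r ^ 2 :=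
        sum_le_sum fun i _ => pow_le_pow_left₀ (norm_nonneg _) (hx i) 2
    _ = d * r ^ 2 := by simp

theorem exists_torusNorm_le_sqrt_mul_abs_rep (hd : 1 ≤ d) (x : Torus d L) :
    ∃ i, torusNorm x ≤ √d * |rep x i| := by
  have : NeZero d := ⟨by lia⟩
  obtain ⟨i, hi⟩ := Finite.exists_max fun i => |rep x i|
  exact ⟨i, torusNorm_le_sqrt_mul (abs_nonneg _) hi⟩

theorem one_le_torusNorm {x : Torus d L} (hx : x ≠ 0) : 1 ≤ torusNorm x := by
  obtain ⟨i, hi⟩ := Function.ne_iff.1 hx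
  refine le_trans ?_ (abs_rep_apply_le_torusNorm x i)
  rw [abs_rep_apply, Nat.one_le_cast, Nat.one_le_iff_ne_zero, Int.natAbs_ne_zero, ne_eq,
    ZMod.valMinAbs_eq_zero]
  exact hi

theorem rep_neg {x : Torus d L} (hx : 2 * torusNorm x < L) : rep (-x) = -rep x := by
  ext i
  have hhalf : (x i).valMinAbs * 2 ≠ L := fun h => by
    have hL : ((x i).valMinAbs : ℝ) * 2 = L := by exact_mod_cast h
    linarith [rep_apply x i, le_abs_self (rep x i), abs_rep_apply_le_torusNorm x i]
  rw [PiLp.neg_apply, rep_apply, rep_apply, Pi.neg_apply, ZMod.valMinAbs_neg_of_ne_half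
    (hhalf ∘ (ZMod.valMinAbs_mul_two_eq_iff _).2), Int.cast_neg]

theorem torusNorm_neg (x : Torus d L) : torusNorm (-x) = torusNorm x := by
  simp only [torusNorm, EuclideanSpace.norm_eq, Real.norm_eq_abs, abs_rep_apply, Pi.neg_apply,
    ZMod.natAbs_valMinAbs_neg]

theorem card_torusNorm_le [NeZero L] {r : ℝ} (hr : 0 ≤ r) :
    (#{x : Torus d L | torusNorm x ≤ r} : ℝ) ≤ (2 * r + 1) ^ d := by
  have hcard : #{x : Torus d L | torusNorm x ≤ r} ≤
      #(Fintype.piFinset fun _ : Fin d => Icc (-⌊r⌋) ⌊r⌋) := by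
    refine card_le_card_of_injOn (fun x i => (x i).valMinAbs) (fun x hx => ?_) fun x _ y _ hxy =>
      funext fun i => ZMod.injective_valMinAbs (congrFun hxy i)
    have hxr : torusNorm x ≤ r := by simpa using hx
    refine Fintype.mem_piFinset.2 fun i => mem_Icc.2 (abs_le.1 (Int.le_floor.2 ?_))
    rw [Int.cast_abs, ← rep_apply]
    exact (abs_rep_apply_le_torusNorm x i).trans hxr
  have hside : ((#(Icc (-⌊r⌋) ⌊r⌋) : ℕ) : ℝ) ≤ 2 * r + 1 := by
    have hfloor := Int.floor_nonneg.2 hr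
    have hcast : ((#(Icc (-⌊r⌋) ⌊r⌋) : ℕ) : ℤ) = 2 * ⌊r⌋ + 1 := by
      rw [Int.card_Icc, Int.toNat_of_nonneg (by lia)]
      ring
    have : ((#(Icc (-⌊r⌋) ⌊r⌋) : ℕ) : ℝ) = 2 * ⌊r⌋ + 1 := by exact_mod_cast hcast
    linarith [Int.floor_le r]
  rw [Fintype.card_piFinset_const] at hcard
  calc (#{x : Torus d L | torusNorm x ≤ r} : ℝ) ≤ (#(Icc (-⌊r⌋) ⌊r⌋) : ℝ) ^ d := by
        exact_mod_cast hcard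
    _ ≤ (2 * r + 1) ^ d := by gcongr

theorem card_ne_zero_torusNorm_le [NeZero L] {r : ℝ} (hr : 0 < r) :
    (#{x ∈ {x : Torus d L | x ≠ 0} | torusNorm x ≤ r} : ℝ) ≤ 3 ^ d * r ^ (d : ℝ) := by
  rcases lt_or_ge r 1 with hr1 | hr1
  · rw [filter_false_of_mem fun x hx => ?_]
    · rw [card_empty, Nat.cast_zero]
      positivity
    · exact (hr1.trans_le (one_le_torusNorm (mem_filter.1 hx).2)).not_ge
  · calc (#{x ∈ {x : Torus d L | x ≠ 0} | torusNorm x ≤ r} : ℝ)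
        ≤ #{x : Torus d L | torusNorm x ≤ r} :=
          Nat.cast_le.2 (card_le_card (filter_subset_filter _ (subset_univ _)))
      _ ≤ (2 * r + 1) ^ d := card_torusNorm_le hr.le
      _ ≤ (3 * r) ^ d := by gcongr; linarith
      _ = 3 ^ d * r ^ (d : ℝ) := by rw [mul_pow, Real.rpow_natCast]

theorem pow_le_card_torusNorm_le [NeZero L] (hd : 1 ≤ d) (hL : 2 ≤ L) {ρ : ℝ} (hρ : 0 ≤ ρ)
    (hρL : ρ ≤ L / 2) :
    ρ ^ d ≤ #{x : Torus d L | x ≠ 0 ∧ torusNorm x ≤ √d * (ρ + 1)} := by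
  have hceil : (⌈ρ⌉₊ : ℝ) < ρ + 1 := Nat.ceil_lt_add_one hρ
  have hceil_lt : ⌈ρ⌉₊ < L := by
    have : (2 : ℝ) ≤ L := by exact_mod_cast hL
    exact_mod_cast (by linarith : (⌈ρ⌉₊ : ℝ) < L)
  have hcard : #(Fintype.piFinset fun _ : Fin d => Icc 1 ⌈ρ⌉₊) ≤
      #{x : Torus d L | x ≠ 0 ∧ torusNorm x ≤ √d * (ρ + 1)} := by
    have hval {k : ℕ} (hk : k ∈ Icc 1 ⌈ρ⌉₊) : (k : ZMod L).val = k :=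
      ZMod.val_natCast_of_lt ((mem_Icc.1 hk).2.trans_lt hceil_lt)
    refine card_le_card_of_injOn (fun k i => (k i : ZMod L)) (fun k hk => ?_)
      fun k hk l hl hkl => funext fun i => ?_
    · rw [mem_coe, Fintype.mem_piFinset] at hk
      refine mem_filter.2 ⟨mem_univ _, Function.ne_iff.2 ⟨⟨0, hd⟩, fun h => ?_⟩,
        torusNorm_le_sqrt_mul (by positivity) fun i => ?_⟩
      · have hpos := (mem_Icc.1 (hk ⟨0, hd⟩)).1
        rw [← hval (hk ⟨0, hd⟩), show (k ⟨0, hd⟩ : ZMod L) = 0 from h, ZMod.val_zero] at hpos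
        exact one_ne_zero (Nat.le_zero.1 hpos)
      · rw [abs_rep_apply, ZMod.valMinAbs_natAbs_eq_min, hval (hk i)]
        exact (Nat.cast_le.2 ((min_le_left _ _).trans (mem_Icc.1 (hk i)).2)).trans hceil.le
    · rw [mem_coe, Fintype.mem_piFinset] at hk hl
      rw [← hval (hk i), ← hval (hl i)]
      exact congrArg ZMod.val (congrFun hkl i)
  rw [Fintype.card_piFinset_const, Nat.card_Icc, Nat.add_sub_cancel] at hcard
  calc ρ ^ d ≤ (⌈ρ⌉₊ : ℝ) ^ d := by gcongr; exact Nat.le_ceil ρ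
    _ ≤ _ := by exact_mod_cast hcard

theorem abs_rep_apply_le_half [NeZero L] (x : Torus d L) (i : Fin d) : |rep x i| ≤ L / 2 := by
  rw [abs_rep_apply]
  exact (Nat.cast_le.2 (ZMod.natAbs_valMinAbs_le _)).trans Nat.cast_div_le

theorem torusNorm_le_sqrt_mul_half [NeZero L] (x : Torus d L) : torusNorm x ≤ √d * (L / 2) :=
  torusNorm_le_sqrt_mul (by positivity) (abs_rep_apply_le_half x)

end TorusNorm

section StableProfile

variable {d L : ℕ} {α V : ℝ}

/-- The `α`-stable profile at scale `V` on the torus: the order of magnitude of the jump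
probabilities of a walk with bandwidth `V` whose jumps have tails of index `α`. -/
noncomputable def stableProfile (α V : ℝ) (x : Torus d L) : ℝ :=
  V ^ α / max (torusNorm x) V ^ ((d : ℝ) + α)

theorem stableProfile_pos (hV : 0 < V) (α : ℝ) (x : Torus d L) : 0 < stableProfile α V x := by
  have : 0 < max (torusNorm x) V := lt_max_of_lt_right hV
  unfold stableProfile
  positivity

theorem le_stableProfile (hα : 0 < α) (hV : 0 < V) {x : Torus d L} {R : ℝ} (hx : torusNorm x ≤ R)
    (hVR : V ≤ R) : V ^ α / R ^ ((d : ℝ) + α) ≤ stableProfile α V x := by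
  have : 0 < max (torusNorm x) V := lt_max_of_lt_right hV
  unfold stableProfile
  gcongr
  exact max_le hx hVR

theorem stableProfile_le (hα : 0 < α) (hV : 0 < V) {x : Torus d L} {r : ℝ} (hr : 0 < r)
    (hrx : r ≤ max (torusNorm x) V) : stableProfile α V x ≤ V ^ α / r ^ ((d : ℝ) + α) := by
  unfold stableProfile
  gcongr

theorem stableProfile_le_rpow_neg (hα : 0 < α) (hV : 0 < V) (x : Torus d L) :
    stableProfile α V x ≤ V ^ (-(d : ℝ)) := by
  refine (stableProfile_le hα hV hV (le_max_right _ _)).trans_eq ?_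
  rw [← Real.rpow_sub hV]
  congr 1
  ring

theorem stableProfile_le_mul_rpow (hα : 0 < α) (hV : 0 < V) {x : Torus d L} (hx : x ≠ 0) :
    stableProfile α V x ≤ V ^ α * torusNorm x ^ (-((d : ℝ) + α)) := by
  have hx₀ : 0 < torusNorm x := one_pos.trans_le (one_le_torusNorm hx)
  rw [Real.rpow_neg hx₀.le, ← div_eq_mul_inv]
  exact stableProfile_le hα hV hx₀ (le_max_left _ _)

theorem max_norm_inv_smul_rep_rpow (hV : 0 < V) (α : ℝ) (x : Torus d L) :
    max ‖V⁻¹ • rep x‖ 1 ^ (-(d : ℝ) - α) = V ^ d * stableProfile α V x := by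
  have hmax : max ‖V⁻¹ • rep x‖ 1 = max (torusNorm x) V / V := by
    rw [norm_smul, norm_inv, Real.norm_of_nonneg hV.le, inv_mul_eq_div, ← div_self hV.ne',
      max_div_div_right hV.le, torusNorm]
  have hpos : 0 < max (torusNorm x) V := lt_max_of_lt_right hV
  rw [hmax, ← neg_add', Real.rpow_neg (by positivity), Real.div_rpow hpos.le hV.le, inv_div,
    Real.rpow_add hV, Real.rpow_natCast, mul_div_assoc, stableProfile]

theorem pow_mul_stableProfile_le (hα : 0 < α) {W : ℝ} (hV : 0 < V) (hVW : V ≤ W) (x : Torus d L) :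
    V ^ d * stableProfile α V x ≤ W ^ d * stableProfile α W x := by
  have hW : 0 < W := hV.trans_le hVW
  rw [← max_norm_inv_smul_rep_rpow hV, ← max_norm_inv_smul_rep_rpow hW]
  refine Real.rpow_le_rpow_of_nonpos (by positivity) ?_ (by linarith [d.cast_nonneg (α := ℝ)])
  rw [norm_smul, norm_smul, norm_inv, norm_inv, Real.norm_of_nonneg hV.le,
    Real.norm_of_nonneg hW.le]
  gcongr

theorem pow_mul_stableProfile_le_one (hα : 0 < α) (hV : 0 < V) (x : Torus d L) :
    V ^ d * stableProfile α V x ≤ 1 := by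
  rw [← max_norm_inv_smul_rep_rpow hV]
  exact Real.rpow_le_one_of_one_le_of_nonpos (le_max_right _ _)
    (by linarith [d.cast_nonneg (α := ℝ)])

theorem one_le_sqrt_rpow_mul_pow_mul_stableProfile_side [NeZero L] (hd : 1 ≤ d)
    (hα : 0 < α) (x : Torus d L) :
    1 ≤ √d ^ ((d : ℝ) + α) * ((L : ℝ) ^ d * stableProfile α L x) := by
  have hL : (0 : ℝ) < L := Nat.cast_pos.2 (NeZero.pos L)
  have hsqrt : 1 ≤ √(d : ℝ) := Real.one_le_sqrt.2 (by exact_mod_cast hd)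
  calc (1 : ℝ)
      = √d ^ ((d : ℝ) + α) * ((L : ℝ) ^ d * ((L : ℝ) ^ α / (√d * L) ^ ((d : ℝ) + α))) := by
        rw [Real.mul_rpow (by positivity) hL.le, Real.rpow_add hL, Real.rpow_natCast]
        field_simp
    _ ≤ _ := by
        gcongr
        refine le_stableProfile hα hL ((torusNorm_le_sqrt_mul_half x).trans ?_)
          (le_mul_of_one_le_left hL.le hsqrt)
        gcongr
        linarith

theorem exists_sum_stableProfile_mul_sq_le (d : ℕ) (hα : α ∈ Set.Ioo (0 : ℝ) 2) :
    ∃ K : ℝ, 0 < K ∧ ∀ (L : ℕ) [NeZero L] (V ρ : ℝ), 0 < V → 0 < ρ →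
      ∑ x : Torus d L with x ≠ 0 ∧ torusNorm x ≤ ρ, stableProfile α V x * torusNorm x ^ 2 ≤
        K * V ^ α * ρ ^ (2 - α) := by
  have hexp : 0 < (d : ℝ) + (2 - (d + α)) := by linarith [hα.2]
  have hgap : 0 < 1 - (2 : ℝ) ^ (-((d : ℝ) + (2 - (d + α)))) :=
    sub_pos.2 (Real.rpow_lt_one_of_one_lt_of_neg one_lt_two (neg_lt_zero.2 hexp))
  refine ⟨3 ^ d * 2 ^ |2 - ((d : ℝ) + α)| / (1 - 2 ^ (-((d : ℝ) + (2 - (d + α))))),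
    by positivity, fun L _ V ρ hV hρ => ?_⟩
  rw [← filter_filter]
  calc ∑ x ∈ {x : Torus d L | x ≠ 0} with torusNorm x ≤ ρ, stableProfile α V x * torusNorm x ^ 2
      ≤ ∑ x ∈ {x : Torus d L | x ≠ 0} with torusNorm x ≤ ρ,
          V ^ α * torusNorm x ^ (2 - ((d : ℝ) + α)) := by
        refine sum_le_sum fun x hx => ?_
        have hx₀ : x ≠ 0 := by simpa using (mem_filter.1 (mem_filter.1 hx).1).2
        refine (mul_le_mul_of_nonneg_right (stableProfile_le_mul_rpow hα.1 hV hx₀)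
          (sq_nonneg _)).trans_eq ?_
        rw [sub_eq_neg_add, Real.rpow_add (one_pos.trans_le (one_le_torusNorm hx₀)), mul_assoc,
          Real.rpow_ofNat]
    _ ≤ V ^ α * (3 ^ d * 2 ^ |2 - ((d : ℝ) + α)| / (1 - 2 ^ (-((d : ℝ) + (2 - (d + α))))) *
          ρ ^ ((d : ℝ) + (2 - (d + α)))) := by
        rw [← mul_sum]
        gcongr
        exact sum_rpow_le_of_le
          (fun x hx => one_pos.trans_le (one_le_torusNorm (mem_filter.1 hx).2))
          (fun r hr => card_ne_zero_torusNorm_le hr) hexp hρ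
    _ = _ := by rw [show (d : ℝ) + (2 - (d + α)) = 2 - α by ring]; ring

theorem exists_sum_stableProfile_le (d : ℕ) (hα : 0 < α) :
    ∃ K : ℝ, 0 < K ∧ ∀ (L : ℕ) [NeZero L] (V : ℝ), 0 < V →
      ∑ x : Torus d L with x ≠ 0, stableProfile α V x ≤ K := by
  have hexp : (d : ℝ) + -(d + α) < 0 := by linarith
  have hgap : 0 < 1 - (2 : ℝ) ^ ((d : ℝ) + -(d + α)) :=
    sub_pos.2 (Real.rpow_lt_one_of_one_lt_of_neg one_lt_two hexp)
  set T : ℝ := 3 ^ d * 2 ^ |-((d : ℝ) + α)| * 2 ^ ((d : ℝ) + -(d + α)) /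
    (1 - 2 ^ ((d : ℝ) + -(d + α)))
  refine ⟨3 ^ d + T, by positivity, fun L _ V hV => ?_⟩
  have hcard (r : ℝ) (hr : 0 < r) := card_ne_zero_torusNorm_le (d := d) (L := L) hr
  have hpos (x : Torus d L) (hx : x ∈ ({x | x ≠ 0} : Finset (Torus d L))) : 0 < torusNorm x :=
    one_pos.trans_le (one_le_torusNorm (mem_filter.1 hx).2)
  have hnear : ∑ x ∈ {x : Torus d L | x ≠ 0} with torusNorm x ≤ V, stableProfile α V x ≤ 3 ^ d :=
    calc ∑ x ∈ {x : Torus d L | x ≠ 0} with torusNorm x ≤ V, stableProfile α V x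
        ≤ #{x ∈ {x : Torus d L | x ≠ 0} | torusNorm x ≤ V} * V ^ (-(d : ℝ)) := by
          rw [← nsmul_eq_mul]
          exact sum_le_card_nsmul _ _ _ fun x _ => stableProfile_le_rpow_neg hα hV x
      _ ≤ 3 ^ d * V ^ (d : ℝ) * V ^ (-(d : ℝ)) := by gcongr; exact hcard V hV
      _ = 3 ^ d := by rw [mul_assoc, ← Real.rpow_add hV, add_neg_cancel, Real.rpow_zero, mul_one]
  have hfar : ∑ x ∈ {x : Torus d L | x ≠ 0} with V < torusNorm x, stableProfile α V x ≤ T :=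
    calc ∑ x ∈ {x : Torus d L | x ≠ 0} with V < torusNorm x, stableProfile α V x
        ≤ ∑ x ∈ {x : Torus d L | x ≠ 0} with V < torusNorm x,
            V ^ α * torusNorm x ^ (-((d : ℝ) + α)) := sum_le_sum fun x hx =>
          stableProfile_le_mul_rpow hα hV (mem_filter.1 (mem_filter.1 hx).1).2
      _ ≤ V ^ α * (T * V ^ ((d : ℝ) + -(d + α))) := by
          rw [← mul_sum]
          gcongr
          exact sum_rpow_le_of_lt hpos hcard hexp hV
      _ = T * V ^ (α + ((d : ℝ) + -(d + α))) := by rw [Real.rpow_add hV α]; ring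
      _ = T := by rw [show α + ((d : ℝ) + -(d + α)) = 0 by ring, Real.rpow_zero, mul_one]
  rw [← sum_filter_add_sum_filter_not _ fun x => torusNorm x ≤ V]
  simp only [not_le]
  exact add_le_add hnear hfar

theorem exists_le_sum_stableProfile (hd : 1 ≤ d) (hα : 0 < α) {V₀ : ℝ} (hV₀ : 0 < V₀) :
    ∃ k : ℝ, 0 < k ∧ ∀ (L : ℕ) [NeZero L] (V : ℝ), 2 ≤ L → V₀ ≤ V → V ≤ L →
      k ≤ ∑ x : Torus d L with x ≠ 0, stableProfile α V x := by
  set M : ℝ := √d * (1 + V₀⁻¹)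
  have hsqrt : 1 ≤ √(d : ℝ) := Real.one_le_sqrt.2 (by exact_mod_cast hd)
  have hM : 1 ≤ M := one_le_mul_of_one_le_of_one_le hsqrt (by linarith [inv_pos.2 hV₀])
  refine ⟨1 / (2 ^ d * M ^ ((d : ℝ) + α)), by positivity, fun L _ V hL hV hVL => ?_⟩
  have hV_pos : 0 < V := hV₀.trans_le hV
  have hradius : √d * (V / 2 + 1) ≤ M * V := by
    have : 1 ≤ V₀⁻¹ * V := by rwa [inv_mul_eq_div, one_le_div hV₀]
    rw [mul_assoc]
    gcongr
    linarith
  calc 1 / (2 ^ d * M ^ ((d : ℝ) + α))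
      = (V / 2) ^ d * (V ^ α / (M * V) ^ ((d : ℝ) + α)) := by
        rw [Real.mul_rpow (by positivity) hV_pos.le, Real.rpow_add hV_pos, Real.rpow_natCast,
          div_pow]
        field_simp
    _ ≤ #{x : Torus d L | x ≠ 0 ∧ torusNorm x ≤ √d * (V / 2 + 1)} *
          (V ^ α / (M * V) ^ ((d : ℝ) + α)) := by
        gcongr
        exact pow_le_card_torusNorm_le hd hL (by positivity) (by linarith)
    _ ≤ ∑ x : Torus d L with x ≠ 0 ∧ torusNorm x ≤ √d * (V / 2 + 1), stableProfile α V x := by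
        rw [← nsmul_eq_mul]
        exact card_nsmul_le_sum _ _ _ fun x hx => le_stableProfile hα hV_pos
          ((mem_filter.1 hx).2.2.trans hradius) (le_mul_of_one_le_left hV_pos.le hM)
    _ ≤ ∑ x : Torus d L with x ≠ 0, stableProfile α V x :=
        sum_le_sum_of_subset_of_nonneg (monotone_filter_right _ fun _ _ => And.left)
          fun x _ _ => (stableProfile_pos hV_pos α x).le

/-- A step law on the torus which is comparable, off the origin, with the `α`-stable profile at
scale `V`. Symmetry is only required at the points where negation commutes with the choice of
representatives: a symmetric profile on `ℝ^d` gives no more, since a coordinate `L / 2` is its own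
negative in `ZMod L`. -/
structure IsStableKernel [NeZero L] (p : Torus d L → ℝ) (α V c₁ c₂ : ℝ) : Prop where
  scale_pos : 0 < V
  mem_stdSimplex : p ∈ stdSimplex ℝ (Torus d L)
  lower : ∀ x, x ≠ 0 → c₁ * stableProfile α V x ≤ p x
  upper : ∀ x, p x ≤ c₂ * stableProfile α V x
  symm : ∀ x, rep (-x) = -rep x → p (-x) = p x

end StableProfile

section OnDiagonal

variable {d L : ℕ} [NeZero L] {p : Torus d L → ℝ} {α V c₁ c₂ : ℝ}

theorem IsStableKernel.apply_le_rpow_neg (hp : IsStableKernel p α V c₁ c₂) (hα : 0 < α)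
    (hc₂ : 0 ≤ c₂) (x : Torus d L) : p x ≤ c₂ * V ^ (-(d : ℝ)) :=
  (hp.upper x).trans
    (mul_le_mul_of_nonneg_left (stableProfile_le_rpow_neg hα hp.scale_pos x) hc₂)

theorem IsStableKernel.energy_le_rpow_neg (hp : IsStableKernel p α V c₁ c₂) (hα : 0 < α)
    (hc₂ : 0 ≤ c₂) {n : ℕ} (hn : 1 ≤ n) : energy p n ≤ c₂ * V ^ (-(d : ℝ)) := by
  obtain ⟨k, rfl⟩ := Nat.exists_eq_add_of_le' hn
  exact energy_le_of_convPow_le hp.mem_stdSimplex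
    (convPow_succ_le_of_forall_le hp.mem_stdSimplex (hp.apply_le_rpow_neg hα hc₂) k)

theorem IsStableKernel.energy_succ_le_of_radius (hp : IsStableKernel p α V c₁ c₂) (hd : 1 ≤ d)
    (hα : 0 < α) (hc₁ : 0 ≤ c₁) (hL : 2 ≤ L) {D ρ : ℝ} (hD : 2 * √d ≤ D) (hρ : 1 ≤ ρ)
    (hρL : ρ ≤ L / 2) (hVρ : V ≤ D * ρ) {n : ℕ} (hE : 2 ≤ ρ ^ d * energy p n) :
    energy p (n + 1) ≤
      energy p n * (1 - c₁ / (2 * D ^ ((d : ℝ) + α)) * (V / ρ) ^ α) := by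
  have hV := hp.scale_pos
  have hsqrt : 0 < √(d : ℝ) := Real.sqrt_pos.2 (by exact_mod_cast hd)
  have hD_pos : 0 < D := by linarith
  set B : Finset (Torus d L) := {x | x ≠ 0 ∧ torusNorm x ≤ √d * (ρ + 1)}
  set β : ℝ := c₁ * (V ^ α / (D * ρ) ^ ((d : ℝ) + α)) with hβ
  have hβ_nonneg : 0 ≤ β := by positivity
  have hpB (x : Torus d L) (hx : x ∈ B) : β ≤ p x := by
    obtain ⟨-, hx₀, hxρ⟩ := mem_filter.1 hx
    have hradius : √d * (ρ + 1) ≤ D * ρ := by nlinarith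
    exact (mul_le_mul_of_nonneg_left (le_stableProfile hα hV (hxρ.trans hradius) hVρ) hc₁).trans
      (hp.lower x hx₀)
  have hcard : ρ ^ d ≤ #B := pow_le_card_torusNorm_le hd hL (by positivity) hρL
  have hE_pos := energy_pos hp.mem_stdSimplex n
  have hrate : β * ρ ^ d = 2 * (c₁ / (2 * D ^ ((d : ℝ) + α)) * (V / ρ) ^ α) := by
    rw [hβ, Real.mul_rpow hD_pos.le (by positivity), Real.rpow_add (by positivity : 0 < ρ),
      Real.rpow_natCast, Real.div_rpow hV.le (by positivity)]
    field_simp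
  calc energy p (n + 1) ≤ (1 - β * #B) * energy p n + β :=
        energy_succ_le_of_forall_mem_le hp.mem_stdSimplex hβ_nonneg hpB n
    _ ≤ (1 - β * ρ ^ d) * energy p n + β * (ρ ^ d * energy p n / 2) := by
        gcongr
        exact le_mul_of_one_le_right hβ_nonneg (by linarith)
    _ = energy p n * (1 - β * ρ ^ d / 2) := by ring
    _ = energy p n * (1 - c₁ / (2 * D ^ ((d : ℝ) + α)) * (V / ρ) ^ α) := by rw [hrate]; ring

theorem exists_energy_succ_le (hd : 1 ≤ d) (hα : 0 < α) (hc₁ : 0 < c₁) (hc₂ : 0 ≤ c₂) :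
    ∃ κ : ℝ, 0 < κ ∧ ∀ (L : ℕ) [NeZero L], 2 ≤ L → ∀ (V : ℝ) (p : Torus d L → ℝ),
      IsStableKernel p α V c₁ c₂ → ∀ n : ℕ, 1 ≤ n → 2 * 2 ^ d / (L : ℝ) ^ d ≤ energy p n →
        energy p (n + 1) ≤ energy p n * (1 - κ * V ^ α * energy p n ^ (α / d)) := by
  have hd₀ : d ≠ 0 := by lia
  have hsqrt : 1 ≤ √(d : ℝ) := Real.one_le_sqrt.2 (by exact_mod_cast hd)
  set D : ℝ := max (2 * √d) c₂
  have hD : 2 * √d ≤ D := le_max_left _ _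
  have hc₂D : c₂ ≤ D := le_max_right _ _
  have hD_one : 1 ≤ D := by linarith
  refine ⟨c₁ / (2 * D ^ ((d : ℝ) + α)) * 2 ^ (-(α / d)), by positivity,
    fun L _ hL V p hp n hn hE => ?_⟩
  have hV := hp.scale_pos
  set e := energy p n with he
  have he_pos : 0 < e := energy_pos hp.mem_stdSimplex n
  have he_one : e ≤ 1 := energy_le_one hp.mem_stdSimplex n
  have he_scale : e ≤ c₂ * V ^ (-(d : ℝ)) := hp.energy_le_rpow_neg hα hc₂ hn
  -- A law of energy `e` charges about `1 / e` points, and a ball of radius `ρ` has twice as many,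
  -- so the law must vary on it.
  set ρ : ℝ := (2 / e) ^ (1 / (d : ℝ)) with hρ
  have hρ_one : 1 ≤ ρ := Real.one_le_rpow ((one_le_div he_pos).2 (by linarith)) (by positivity)
  have hρ_pow : ρ ^ d = 2 / e := by
    rw [hρ, one_div, Real.rpow_inv_natCast_pow (by positivity) hd₀]
  have hρL : ρ ≤ L / 2 := by
    refine le_of_pow_le_pow_left₀ hd₀ (by positivity) ?_
    have : (0 : ℝ) < L := by exact_mod_cast (by lia : 0 < L)
    rw [div_le_iff₀ (by positivity)] at hE
    rw [hρ_pow, div_pow, div_le_div_iff₀ he_pos (by positivity)]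
    linarith
  have hVρ : V ≤ D * ρ := by
    refine le_of_pow_le_pow_left₀ hd₀ (by positivity) ?_
    rw [Real.rpow_neg hV.le, Real.rpow_natCast, ← div_eq_mul_inv, le_div_iff₀' (by positivity)]
      at he_scale
    rw [mul_pow, hρ_pow, mul_div_assoc', le_div_iff₀ he_pos]
    linarith [le_self_pow₀ hD_one hd₀]
  have hrate : (V / ρ) ^ α = 2 ^ (-(α / d)) * V ^ α * e ^ (α / d) := by
    rw [Real.div_rpow hV.le (by positivity), hρ, ← Real.rpow_mul (by positivity),
      one_div_mul_eq_div, Real.div_rpow two_pos.le he_pos.le, Real.rpow_neg two_pos.le]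
    field_simp
  have hstep := hp.energy_succ_le_of_radius hd hα hc₁.le hL hD hρ_one hρL hVρ (n := n)
    (by rw [hρ_pow, div_mul_cancel₀ _ he_pos.ne'])
  rw [hrate] at hstep
  exact hstep.trans_eq (by ring)

theorem exists_energy_le (hd : 1 ≤ d) (hα : 0 < α) (hc₁ : 0 < c₁) (hc₂ : 0 < c₂) :
    ∃ A : ℝ, 0 < A ∧ ∀ (L : ℕ) [NeZero L], 2 ≤ L → ∀ (V : ℝ) (p : Torus d L → ℝ),
      IsStableKernel p α V c₁ c₂ → ∀ n : ℕ, 1 ≤ n →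
        energy p n ≤ A * ((n * V ^ α) ^ (-((d : ℝ) / α)) + 1 / (L : ℝ) ^ d) := by
  obtain ⟨κ, hκ, hstep⟩ := exists_energy_succ_le hd hα hc₁ hc₂.le
  have hd₀ : (0 : ℝ) < d := by exact_mod_cast hd
  set γ : ℝ := α / d with hγ
  have hγ_pos : 0 < γ := by positivity
  set c : ℝ := min (γ * κ) (c₂ ^ (-γ))
  have hc : 0 < c := lt_min (by positivity) (by positivity)
  refine ⟨2 * 2 ^ d + c ^ (-((d : ℝ) / α)), by positivity, fun L _ hL V p hp n hn => ?_⟩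
  have hV := hp.scale_pos
  have hE_pos := energy_pos hp.mem_stdSimplex
  have hc_one : c * V ^ α ≤ energy p 1 ^ (-γ) :=
    calc c * V ^ α ≤ c₂ ^ (-γ) * V ^ α := by gcongr; exact min_le_right _ _
      _ = (c₂ * V ^ (-(d : ℝ))) ^ (-γ) := by
          rw [Real.mul_rpow hc₂.le (by positivity), ← Real.rpow_mul hV.le, hγ, neg_mul_neg,
            mul_div_cancel₀ _ hd₀.ne']
      _ ≤ energy p 1 ^ (-γ) := Real.rpow_le_rpow_of_nonpos (hE_pos 1)
          (hp.energy_le_rpow_neg hα hc₂.le le_rfl) (neg_nonpos.2 hγ_pos.le)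
  have hc_rate : c * V ^ α ≤ γ * (κ * V ^ α) := by
    rw [← mul_assoc]
    gcongr
    exact min_le_left _ _
  have : (0 : ℝ) < n := by exact_mod_cast hn
  rcases le_or_mul_le_rpow_neg hγ_pos.le hE_pos (energy_antitone hp.mem_stdSimplex) hc_rate hc_one
    (hstep L hL V p hp) hn with hle | hle
  · calc energy p n ≤ 2 * 2 ^ d * (1 / (L : ℝ) ^ d) := by rwa [mul_one_div]
      _ ≤ _ := mul_le_mul (le_add_of_nonneg_right (by positivity))
          (le_add_of_nonneg_left (by positivity)) (by positivity) (by positivity)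
  · calc energy p n = (energy p n ^ (-γ)) ^ (-((d : ℝ) / α)) := by
          rw [← Real.rpow_mul (hE_pos n).le, hγ, neg_mul_neg, div_mul_div_cancel₀ hd₀.ne',
            div_self hα.ne', Real.rpow_one]
      _ ≤ (c * (n * V ^ α)) ^ (-((d : ℝ) / α)) :=
          Real.rpow_le_rpow_of_nonpos (by positivity) (by linarith) (neg_nonpos.2 (by positivity))
      _ = c ^ (-((d : ℝ) / α)) * (n * V ^ α) ^ (-((d : ℝ) / α)) :=
          Real.mul_rpow hc.le (by positivity)
      _ ≤ _ := mul_le_mul (le_add_of_nonneg_left (by positivity))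
          (le_add_of_nonneg_right (by positivity)) (by positivity) (by positivity)

theorem rpow_neg_add_le_of_le_three_mul {m n : ℕ} (hn : 1 ≤ n) (hnm : n ≤ 3 * m) {v b ε : ℝ}
    (hv : 0 < v) (hb : 0 ≤ b) (hε : 0 ≤ ε) :
    (m * v) ^ (-b) + ε ≤ 3 ^ b * ((n * v) ^ (-b) + ε) := by
  have : (0 : ℝ) < n := by exact_mod_cast hn
  have htime : n * v / 3 ≤ m * v := by
    rw [div_le_iff₀' three_pos, ← mul_assoc]
    gcongr
    exact_mod_cast hnm
  have hpow : (m * v) ^ (-b) ≤ 3 ^ b * (n * v) ^ (-b) :=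
    calc (m * v) ^ (-b) ≤ (n * v / 3) ^ (-b) :=
          Real.rpow_le_rpow_of_nonpos (by positivity) htime (neg_nonpos.2 hb)
      _ = 3 ^ b * (n * v) ^ (-b) := by
          rw [Real.div_rpow (by positivity) three_pos.le, Real.rpow_neg three_pos.le,
            div_inv_eq_mul, mul_comm]
  rw [mul_add]
  exact add_le_add hpow (le_mul_of_one_le_left hε (Real.one_le_rpow (by norm_num) hb))

theorem exists_add_eq_le_three_mul {n : ℕ} (hn : 2 ≤ n) :
    ∃ j k, 1 ≤ j ∧ 1 ≤ k ∧ j + k = n ∧ n ≤ 3 * j ∧ n ≤ 3 * k :=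
  ⟨n / 2, n - n / 2, by lia, by lia, by lia, by lia, by lia⟩

theorem exists_convPow_le (hd : 1 ≤ d) (hα : 0 < α) (hc₁ : 0 < c₁) (hc₂ : 0 < c₂) :
    ∃ A : ℝ, 0 < A ∧ ∀ (L : ℕ) [NeZero L], 2 ≤ L → ∀ (V : ℝ) (p : Torus d L → ℝ),
      IsStableKernel p α V c₁ c₂ → ∀ n : ℕ, 1 ≤ n → ∀ x,
        convPow p n x ≤ A * ((n * V ^ α) ^ (-((d : ℝ) / α)) + 1 / (L : ℝ) ^ d) := by
  obtain ⟨A, hA, hE⟩ := exists_energy_le hd hα hc₁ hc₂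
  refine ⟨c₂ + A * 3 ^ ((d : ℝ) / α), by positivity, fun L _ hL V p hp n hn x => ?_⟩
  have hV := hp.scale_pos
  have : (0 : ℝ) < n := by exact_mod_cast hn
  set S : ℝ := (n * V ^ α) ^ (-((d : ℝ) / α)) + 1 / (L : ℝ) ^ d with hS
  have hS_nonneg : 0 ≤ S := by positivity
  rcases hn.eq_or_lt' with rfl | hn₂
  · have hone : V ^ (-(d : ℝ)) ≤ S := by
      rw [hS, Nat.cast_one, one_mul, ← Real.rpow_mul hV.le, mul_neg, mul_div_cancel₀ _ hα.ne']
      exact le_add_of_nonneg_right (by positivity)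
    calc convPow p 1 x ≤ c₂ * V ^ (-(d : ℝ)) := by
          rw [convPow_one]
          exact hp.apply_le_rpow_neg hα hc₂.le x
      _ ≤ (c₂ + A * 3 ^ ((d : ℝ) / α)) * S := by
          gcongr
          exact le_add_of_nonneg_right (by positivity)
  · obtain ⟨j, k, hj, hk, rfl, hnj, hnk⟩ := exists_add_eq_le_three_mul hn₂
    have hpart (m : ℕ) (hm : 1 ≤ m) (hnm : j + k ≤ 3 * m) :
        energy p m ≤ A * 3 ^ ((d : ℝ) / α) * S := by
      refine (hE L hL V p hp m hm).trans ?_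
      rw [mul_assoc]
      gcongr
      exact rpow_neg_add_le_of_le_three_mul hn hnm (by positivity) (by positivity) (by positivity)
    calc convPow p (j + k) x ≤ (energy p j + energy p k) / 2 := convPow_add_le_energy p j k x
      _ ≤ A * 3 ^ ((d : ℝ) / α) * S := by linarith [hpart j hj hnj, hpart k hk hnk]
      _ ≤ (c₂ + A * 3 ^ ((d : ℝ) / α)) * S := by
          gcongr
          exact le_add_of_nonneg_left hc₂.le

end OnDiagonal

section Chernoff

theorem cosh_le_one_add_sq_mul_cosh (u : ℝ) : Real.cosh u ≤ 1 + u ^ 2 / 2 * Real.cosh u := by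
  have hgauss : Real.cosh u * Real.exp (-(u ^ 2 / 2)) ≤ 1 := by
    rw [Real.exp_neg, ← div_eq_mul_inv, div_le_one (Real.exp_pos _)]
    exact Real.cosh_le_exp_half_sq u
  nlinarith [mul_le_mul_of_nonneg_left (Real.add_one_le_exp (-(u ^ 2 / 2))) (Real.cosh_pos u).le]

theorem exp_div_two_le_cosh {s u : ℝ} (hs : s ≤ |u|) : Real.exp s / 2 ≤ Real.cosh u := by
  rw [← Real.cosh_abs, Real.cosh_eq]
  linarith [Real.exp_le_exp.2 hs, Real.exp_pos (-|u|)]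

variable {G : Type*} [Fintype G] {a u : G → ℝ}

theorem sum_mul_cosh_le_exp (ha : ∀ y, 0 ≤ a y) (hmass : ∑ y, a y ≤ 1) {r σ : ℝ}
    (hbdd : ∀ y, a y ≠ 0 → |u y| ≤ r) (hσ : ∑ y, a y * u y ^ 2 ≤ σ) :
    ∑ y, a y * Real.cosh (u y) ≤ Real.exp (Real.cosh r / 2 * σ) := by
  have hterm (y : G) : a y * Real.cosh (u y) ≤ a y + Real.cosh r / 2 * (a y * u y ^ 2) := by
    rcases eq_or_ne (a y) 0 with hy | hy
    · simp [hy]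
    · have hcosh : Real.cosh (u y) ≤ Real.cosh r := Real.cosh_le_cosh.2
        ((hbdd y hy).trans (le_abs_self r))
      calc a y * Real.cosh (u y) ≤ a y * (1 + u y ^ 2 / 2 * Real.cosh r) := by
            refine mul_le_mul_of_nonneg_left ?_ (ha y)
            exact (cosh_le_one_add_sq_mul_cosh _).trans (by gcongr)
        _ = a y + Real.cosh r / 2 * (a y * u y ^ 2) := by ring
  calc ∑ y, a y * Real.cosh (u y)
      ≤ ∑ y, a y + Real.cosh r / 2 * ∑ y, a y * u y ^ 2 := by
        rw [mul_sum, ← sum_add_distrib]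
        exact sum_le_sum fun y _ => hterm y
    _ ≤ 1 + Real.cosh r / 2 * σ := by
        have := Real.cosh_pos r
        gcongr
    _ ≤ Real.exp (Real.cosh r / 2 * σ) := by linarith [Real.add_one_le_exp (Real.cosh r / 2 * σ)]

variable [AddCommGroup G]

theorem sum_mul_sinh_eq_zero (hsymm : ∀ y, a (-y) = a y) (hodd : ∀ y, a y ≠ 0 → u (-y) = -u y) :
    ∑ y, a y * Real.sinh (u y) = 0 := by
  have hneg : ∑ y, a y * Real.sinh (u y) = -∑ y, a y * Real.sinh (u y) := by
    rw [← sum_neg_distrib, ← Equiv.sum_comp (Equiv.neg G) fun y => a y * Real.sinh (u y)]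
    refine sum_congr rfl fun y _ => ?_
    rw [Equiv.neg_apply, hsymm]
    rcases eq_or_ne (a y) 0 with hy | hy
    · rw [hy, zero_mul, zero_mul, neg_zero]
    · rw [hodd y hy, Real.sinh_neg, mul_neg]
  linarith

theorem sum_mul_cosh_add_le (ha : ∀ y, 0 ≤ a y) (hsymm : ∀ y, a (-y) = a y)
    (hodd : ∀ y, a y ≠ 0 → u (-y) = -u y) (hadd : ∀ y z, |u (y + z)| ≤ |u y + u z|) (x : G) :
    ∑ y, a y * Real.cosh (u (y + x)) ≤ (∑ y, a y * Real.cosh (u y)) * Real.cosh (u x) :=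
  calc ∑ y, a y * Real.cosh (u (y + x))
      ≤ ∑ y, a y * Real.cosh (u y + u x) := sum_le_sum fun y _ =>
        mul_le_mul_of_nonneg_left (Real.cosh_le_cosh.2 (hadd y x)) (ha y)
    _ = (∑ y, a y * Real.cosh (u y)) * Real.cosh (u x) +
          (∑ y, a y * Real.sinh (u y)) * Real.sinh (u x) := by
        simp only [Real.cosh_add, mul_add, sum_add_distrib, sum_mul, mul_assoc]
    _ = (∑ y, a y * Real.cosh (u y)) * Real.cosh (u x) := by
        rw [sum_mul_sinh_eq_zero hsymm hodd, zero_mul, add_zero]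

theorem sum_convPow_le_exp [DecidableEq G] (ha : ∀ y, 0 ≤ a y) (hmass : ∑ y, a y ≤ 1)
    (hsymm : ∀ y, a (-y) = a y) (hzero : u 0 = 0) (hodd : ∀ y, a y ≠ 0 → u (-y) = -u y)
    (hadd : ∀ y z, |u (y + z)| ≤ |u y + u z|) {r σ : ℝ} (hbdd : ∀ y, a y ≠ 0 → |u y| ≤ r)
    (hσ : ∑ y, a y * u y ^ 2 ≤ σ) (n : ℕ) (s : ℝ) :
    ∑ x with s ≤ |u x|, convPow a n x ≤ 2 * Real.exp (n * (Real.cosh r / 2 * σ) - s) := by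
  have hmoment : 0 ≤ ∑ y, a y * Real.cosh (u y) :=
    sum_nonneg fun y _ => mul_nonneg (ha y) (Real.cosh_pos _).le
  have hmarkov : (∑ x with s ≤ |u x|, convPow a n x) * (Real.exp s / 2) ≤
      Real.exp (n * (Real.cosh r / 2 * σ)) :=
    calc (∑ x with s ≤ |u x|, convPow a n x) * (Real.exp s / 2)
        ≤ ∑ x with s ≤ |u x|, convPow a n x * Real.cosh (u x) := by
          rw [sum_mul]
          exact sum_le_sum fun x hx => mul_le_mul_of_nonneg_left
            (exp_div_two_le_cosh (mem_filter.1 hx).2) (convPow_nonneg ha n x)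
      _ ≤ ∑ x, convPow a n x * Real.cosh (u x) :=
          sum_le_sum_of_subset_of_nonneg (filter_subset _ _) fun x _ _ =>
            mul_nonneg (convPow_nonneg ha n x) (Real.cosh_pos _).le
      _ ≤ (∑ y, a y * Real.cosh (u y)) ^ n :=
          sum_convPow_mul_le (w := fun x => Real.cosh (u x)) ha hmoment
            (by rw [hzero, Real.cosh_zero]) (sum_mul_cosh_add_le ha hsymm hodd hadd) n
      _ ≤ Real.exp (n * (Real.cosh r / 2 * σ)) := by
          rw [Real.exp_nat_mul]
          exact pow_le_pow_left₀ hmoment (sum_mul_cosh_le_exp ha hmass hbdd hσ) n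
  rw [Real.exp_sub, mul_div_assoc', le_div_iff₀ (Real.exp_pos s)]
  linarith

end Chernoff

section OffDiagonal

theorem sq_mul_cosh_mul_exp_neg_le {u : ℝ} (hu : 0 ≤ u) :
    u ^ 2 * Real.cosh u * Real.exp (-(2 * u)) ≤ 2 := by
  have hcosh : Real.cosh u ≤ Real.exp u := by
    rw [Real.cosh_eq]
    linarith [Real.exp_le_exp.2 (neg_le_self hu)]
  calc u ^ 2 * Real.cosh u * Real.exp (-(2 * u))
      ≤ u ^ 2 * Real.exp u * Real.exp (-(2 * u)) := by gcongr
    _ = u ^ 2 / Real.exp u := by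
        rw [mul_assoc, ← Real.exp_add, div_eq_mul_inv, ← Real.exp_neg]
        ring_nf
    _ ≤ 2 := by
        rw [div_le_iff₀ (Real.exp_pos u)]
        linarith [Real.quadratic_le_exp_of_nonneg hu]

theorem rpow_neg_add_mul_le {b α T ρ ε : ℝ} (hb : 0 < b) (hα : 0 < α) (hT : 0 < T) (hρ : 0 < ρ)
    (hTρ : T ≤ ρ ^ α) (hε : 0 ≤ ε) :
    (T ^ (-(b / α)) + ε) * (T / ρ ^ α) ^ (1 + b / α) ≤ T / ρ ^ (b + α) + ε := by
  have hmain : T ^ (-(b / α)) * (T / ρ ^ α) ^ (1 + b / α) = T / ρ ^ (b + α) := by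
    have hexp : α * (1 + b / α) = b + α := by field_simp; ring
    rw [Real.div_rpow hT.le (by positivity), ← Real.rpow_mul hρ.le, mul_div_assoc',
      ← Real.rpow_add hT, hexp, neg_add_cancel_comm_assoc, Real.rpow_one]
  have hone : (T / ρ ^ α) ^ (1 + b / α) ≤ 1 :=
    Real.rpow_le_one (by positivity) (div_le_one_of_le₀ hTρ (by positivity)) (by positivity)
  rw [add_mul, hmain]
  gcongr
  exact mul_le_of_le_one_right hε hone

theorem rpow_neg_le_div_rpow {b α T ρ : ℝ} (hb : 0 ≤ b) (hα : 0 < α) (hρ : 0 < ρ)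
    (hρT : ρ ^ α ≤ T) : T ^ (-(b / α)) ≤ T / ρ ^ (b + α) :=
  calc T ^ (-(b / α)) ≤ (ρ ^ α) ^ (-(b / α)) :=
        Real.rpow_le_rpow_of_nonpos (by positivity) hρT (neg_nonpos.2 (by positivity))
    _ = ρ ^ α / ρ ^ (b + α) := by
        rw [← Real.rpow_mul hρ.le, ← Real.rpow_sub hρ, mul_neg, mul_div_cancel₀ _ hα.ne']
        ring_nf
    _ ≤ T / ρ ^ (b + α) := by gcongr

variable {d L : ℕ} {p : Torus d L → ℝ} {α V c₁ c₂ ρ : ℝ}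

/-- The truncation of a step law to jumps of length at most `ρ`; the discarded mass is not
redistributed, so the total mass may drop below one. -/
noncomputable def truncate (p : Torus d L → ℝ) (ρ : ℝ) (x : Torus d L) : ℝ :=
  if torusNorm x ≤ ρ then p x else 0

theorem truncate_nonneg (hp : ∀ x, 0 ≤ p x) (x : Torus d L) : 0 ≤ truncate p ρ x :=
  ite_nonneg (hp x) le_rfl

theorem truncate_le (hp : ∀ x, 0 ≤ p x) (x : Torus d L) : truncate p ρ x ≤ p x := by
  unfold truncate
  split_ifs
  exacts [le_rfl, hp x]

theorem torusNorm_le_of_truncate_ne_zero {x : Torus d L} (hx : truncate p ρ x ≠ 0) :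
    torusNorm x ≤ ρ := by
  by_contra hxρ
  exact hx (if_neg hxρ)

theorem exists_mul_le_abs_rep {κ : ℝ} (hd : 1 ≤ d) (hκ : 1 ≤ κ) {x : Torus d L}
    (hV : V < max (torusNorm x) V / (√d * κ)) :
    ∃ i, κ * (max (torusNorm x) V / (√d * κ)) ≤ |rep x i| := by
  have hsqrt : 1 ≤ √(d : ℝ) := Real.one_le_sqrt.2 (by exact_mod_cast hd)
  have hVx : V < torusNorm x := by
    by_contra! hxV
    rw [max_eq_right hxV] at hV
    have : 0 ≤ V := (norm_nonneg _).trans hxV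
    exact hV.not_ge (div_le_self this (one_le_mul_of_one_le_of_one_le hsqrt hκ))
  obtain ⟨i, hi⟩ := exists_torusNorm_le_sqrt_mul_abs_rep hd x
  refine ⟨i, ?_⟩
  rw [max_eq_left hVx.le, mul_div_assoc', mul_comm, mul_div_mul_right _ _ (by positivity),
    div_le_iff₀' (by positivity)]
  exact hi

variable [NeZero L]

theorem IsStableKernel.truncate_neg (hp : IsStableKernel p α V c₁ c₂) (hρL : 2 * ρ < L)
    (x : Torus d L) : truncate p ρ (-x) = truncate p ρ x := by
  unfold truncate
  rw [torusNorm_neg]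
  split_ifs with hx
  · exact hp.symm x (rep_neg (by linarith))
  · rfl

theorem IsStableKernel.le_truncate_add (hp : IsStableKernel p α V c₁ c₂) (hα : 0 < α)
    (hc₂ : 0 ≤ c₂) (hρ : 0 < ρ) (x : Torus d L) :
    p x ≤ truncate p ρ x + c₂ * (V ^ α / ρ ^ ((d : ℝ) + α)) := by
  have hV := hp.scale_pos
  unfold truncate
  split_ifs with hx
  · exact le_add_of_nonneg_right (by positivity)
  · rw [zero_add]
    exact (hp.upper x).trans (mul_le_mul_of_nonneg_left
      (stableProfile_le hα hV hρ ((not_le.1 hx).le.trans (le_max_left _ _))) hc₂)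

theorem exists_sum_truncate_mul_sq_le (d : ℕ) (hα : α ∈ Set.Ioo (0 : ℝ) 2) (hc₂ : 0 < c₂) :
    ∃ K : ℝ, 0 < K ∧ ∀ (L : ℕ) [NeZero L] (V : ℝ) (p : Torus d L → ℝ),
      IsStableKernel p α V c₁ c₂ → ∀ ρ : ℝ, 0 < ρ →
        ∑ x, truncate p ρ x * torusNorm x ^ 2 ≤ K * V ^ α * ρ ^ (2 - α) := by
  obtain ⟨K, hK, hmoment⟩ := exists_sum_stableProfile_mul_sq_le d hα
  refine ⟨c₂ * K, by positivity, fun L _ V p hp ρ hρ => ?_⟩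
  calc ∑ x, truncate p ρ x * torusNorm x ^ 2
      ≤ c₂ * ∑ x with x ≠ 0 ∧ torusNorm x ≤ ρ, stableProfile α V x * torusNorm x ^ 2 := by
        rw [mul_sum, sum_filter]
        refine sum_le_sum fun x _ => ?_
        split_ifs with hx
        · rw [truncate, if_pos hx.2, ← mul_assoc]
          gcongr
          exact hp.upper x
        · rcases eq_or_ne x 0 with rfl | hx₀
          · simp [torusNorm, rep_zero]
          · simp [truncate, not_and.1 hx hx₀]
    _ ≤ c₂ * (K * V ^ α * ρ ^ (2 - α)) := by
        gcongr
        exact hmoment L V ρ hp.scale_pos hρ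
    _ = c₂ * K * V ^ α * ρ ^ (2 - α) := by ring

theorem exists_sum_convPow_truncate_le_exp (d : ℕ) (hα : α ∈ Set.Ioo (0 : ℝ) 2) (hc₂ : 0 < c₂) :
    ∃ K : ℝ, 0 < K ∧ ∀ (L : ℕ) [NeZero L] (V : ℝ) (p : Torus d L → ℝ),
      IsStableKernel p α V c₁ c₂ → ∀ ρ : ℝ, 0 < ρ → 2 * ρ < L → ∀ u : ℝ, 0 ≤ u →
        ∀ (n : ℕ) (r : ℝ) (i : Fin d),
          ∑ x with r * ρ ≤ |rep x i|, convPow (truncate p ρ) n x ≤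
            2 * Real.exp (K * (u ^ 2 * Real.cosh u * (n * V ^ α / ρ ^ α)) - u * r) := by
  obtain ⟨K, hK, hmoment⟩ := exists_sum_truncate_mul_sq_le (c₁ := c₁) d hα hc₂
  refine ⟨K / 2, by positivity, fun L _ V p hp ρ hρ hρL u hu n r i => ?_⟩
  have ha := truncate_nonneg (ρ := ρ) hp.mem_stdSimplex.1
  set l : ℝ := u / ρ
  have hl_nonneg : 0 ≤ l := by positivity
  have hlρ : l * ρ = u := div_mul_cancel₀ u hρ.ne'
  have hvar : ∑ y, truncate p ρ y * (l * rep y i) ^ 2 ≤ l ^ 2 * (K * V ^ α * ρ ^ (2 - α)) := by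
    refine le_trans ?_ (mul_le_mul_of_nonneg_left (hmoment L V p hp ρ hρ) (sq_nonneg l))
    rw [mul_sum]
    refine sum_le_sum fun y _ => ?_
    rw [mul_pow, mul_left_comm, ← sq_abs (rep y i)]
    have := ha y
    gcongr
    exact abs_rep_apply_le_torusNorm y i
  calc ∑ x with r * ρ ≤ |rep x i|, convPow (truncate p ρ) n x
      ≤ ∑ x with u * r ≤ |l * rep x i|, convPow (truncate p ρ) n x := by
        refine sum_le_sum_of_subset_of_nonneg (monotone_filter_right _ fun x _ hx => ?_)
          fun x _ _ => convPow_nonneg ha n x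
        rw [abs_mul, abs_of_nonneg hl_nonneg, ← hlρ, mul_assoc, mul_comm ρ]
        exact mul_le_mul_of_nonneg_left hx hl_nonneg
    _ ≤ 2 * Real.exp (n * (Real.cosh u / 2 * (l ^ 2 * (K * V ^ α * ρ ^ (2 - α)))) - u * r) := by
        refine sum_convPow_le_exp (u := fun x : Torus d L => l * rep x i) ha ?_
          (hp.truncate_neg hρL) ?_ (fun y hy => ?_) (fun y z => ?_) (fun y hy => ?_) hvar n _
        · exact hp.mem_stdSimplex.2 ▸ sum_le_sum fun y _ => truncate_le hp.mem_stdSimplex.1 y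
        · simp [rep_zero]
        · rw [rep_neg (by linarith [torusNorm_le_of_truncate_ne_zero hy]), PiLp.neg_apply, mul_neg]
        · rw [← mul_add, abs_mul, abs_mul]
          exact mul_le_mul_of_nonneg_left (abs_rep_add_apply_le y z i) (abs_nonneg l)
        · rw [abs_mul, abs_of_nonneg hl_nonneg, ← hlρ]
          gcongr
          exact (abs_rep_apply_le_torusNorm y i).trans (torusNorm_le_of_truncate_ne_zero hy)
    _ = 2 * Real.exp (K / 2 * (u ^ 2 * Real.cosh u * (n * V ^ α / ρ ^ α)) - u * r) := by
        rw [Real.rpow_sub hρ, Real.rpow_two, ← hlρ]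
        ring_nf

theorem exists_sum_convPow_truncate_le (d : ℕ) (hα : α ∈ Set.Ioo (0 : ℝ) 2) (hc₂ : 0 < c₂) :
    ∃ C : ℝ, 0 < C ∧ ∀ (L : ℕ) [NeZero L] (V : ℝ) (p : Torus d L → ℝ),
      IsStableKernel p α V c₁ c₂ → ∀ ρ : ℝ, 0 < ρ → 2 * ρ < L →
        ∀ t ∈ Set.Ioc (0 : ℝ) 1, ∀ n : ℕ, n * V ^ α ≤ t * ρ ^ α → ∀ (θ : ℝ) (i : Fin d),
          ∑ x with 2 * θ * ρ ≤ |rep x i|, convPow (truncate p ρ) n x ≤ C * t ^ θ := by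
  obtain ⟨K, hK, htail⟩ := exists_sum_convPow_truncate_le_exp (c₁ := c₁) d hα hc₂
  refine ⟨2 * Real.exp (2 * K), by positivity, fun L _ V p hp ρ hρ hρL t ht n hn θ i => ?_⟩
  -- With this tilt a jump of length `ρ` costs a factor `t ^ (1 / 2)`, while the exponential moment
  -- of the whole walk stays bounded.
  set u : ℝ := -Real.log t / 2 with hu
  have hu_nonneg : 0 ≤ u := by linarith [Real.log_nonpos ht.1.le ht.2]
  have ht_exp : Real.exp (-(2 * u)) = t := by
    rw [hu, mul_div_cancel₀ _ two_ne_zero, neg_neg, Real.exp_log ht.1]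
  have hexponent : u ^ 2 * Real.cosh u * (n * V ^ α / ρ ^ α) ≤ 2 := by
    have := Real.cosh_pos u
    refine le_trans ?_ (sq_mul_cosh_mul_exp_neg_le hu_nonneg)
    rw [ht_exp]
    gcongr
    exact div_le_of_le_mul₀ (by positivity) ht.1.le hn
  calc ∑ x with 2 * θ * ρ ≤ |rep x i|, convPow (truncate p ρ) n x
      ≤ 2 * Real.exp (K * (u ^ 2 * Real.cosh u * (n * V ^ α / ρ ^ α)) - u * (2 * θ)) :=
        htail L V p hp ρ hρ hρL u hu_nonneg n (2 * θ) i
    _ ≤ 2 * Real.exp (K * 2 - u * (2 * θ)) := by gcongr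
    _ = 2 * Real.exp (2 * K + -(2 * u) * θ) := by ring_nf
    _ = 2 * Real.exp (2 * K) * t ^ θ := by
        rw [← ht_exp, ← Real.exp_mul, Real.exp_add, mul_assoc]

theorem exists_convPow_le_of_le_three_mul (hd : 1 ≤ d) (hα : 0 < α) (hc₁ : 0 < c₁)
    (hc₂ : 0 < c₂) :
    ∃ A : ℝ, 0 < A ∧ ∀ (L : ℕ) [NeZero L], 2 ≤ L → ∀ (V : ℝ) (p : Torus d L → ℝ),
      IsStableKernel p α V c₁ c₂ → ∀ m n : ℕ, 1 ≤ m → 1 ≤ n → n ≤ 3 * m → ∀ x,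
        convPow p m x ≤ A * ((n * V ^ α) ^ (-((d : ℝ) / α)) + 1 / (L : ℝ) ^ d) := by
  obtain ⟨A, hA, hdiag⟩ := exists_convPow_le hd hα hc₁ hc₂
  refine ⟨A * 3 ^ ((d : ℝ) / α), by positivity, fun L _ hL V p hp m n hm hn hnm x => ?_⟩
  have hV := hp.scale_pos
  refine (hdiag L hL V p hp m hm x).trans ?_
  rw [mul_assoc]
  gcongr
  exact rpow_neg_add_le_of_le_three_mul hn hnm (by positivity) (by positivity) (by positivity)

theorem exists_convPow_truncate_le (hd : 1 ≤ d) (hα : α ∈ Set.Ioo (0 : ℝ) 2) (hc₁ : 0 < c₁)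
    (hc₂ : 0 < c₂) :
    ∃ C : ℝ, 0 < C ∧ ∀ (L : ℕ) [NeZero L], 2 ≤ L → ∀ (V : ℝ) (p : Torus d L → ℝ),
      IsStableKernel p α V c₁ c₂ → ∀ ρ : ℝ, 0 < ρ → ∀ n : ℕ, 1 ≤ n → n * V ^ α ≤ ρ ^ α →
        ∀ (x : Torus d L) (i : Fin d), 4 * (1 + d / α) * ρ ≤ |rep x i| →
          convPow (truncate p ρ) n x ≤
            C * (n * V ^ α / ρ ^ ((d : ℝ) + α) + 1 / (L : ℝ) ^ d) := by
  have hα₀ := hα.1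
  obtain ⟨A, hA, hdiag⟩ := exists_convPow_le_of_le_three_mul hd hα₀ hc₁ hc₂
  obtain ⟨B, hB, htail⟩ := exists_sum_convPow_truncate_le (c₁ := c₁) d hα hc₂
  refine ⟨2 * A * B, by positivity, fun L _ hL V p hp ρ hρ n hn hnρ x i hx => ?_⟩
  have hV := hp.scale_pos
  have hp₀ := hp.mem_stdSimplex.1
  have hρx : 4 * ρ ≤ |rep x i| := by
    linarith [show 0 ≤ d / α * ρ by positivity]
  rcases hn.eq_or_lt' with rfl | hn₂
  · rw [convPow_one, truncate, if_neg (by linarith [abs_rep_apply_le_torusNorm x i])]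
    positivity
  have hρL : 2 * ρ < L := by linarith [abs_rep_apply_le_half x i]
  have : (0 : ℝ) < n := by exact_mod_cast hn
  have ht : n * V ^ α / ρ ^ α ∈ Set.Ioc (0 : ℝ) 1 :=
    ⟨by positivity, div_le_one_of_le₀ hnρ (by positivity)⟩
  set S : ℝ := (n * V ^ α) ^ (-((d : ℝ) / α)) + 1 / (L : ℝ) ^ d
  have hsup (m : ℕ) (hm : 1 ≤ m) (hnm : n ≤ 3 * m) (y : Torus d L) :
      convPow (truncate p ρ) m y ≤ A * S :=
    (convPow_mono (truncate_nonneg hp₀) (truncate_le hp₀) m y).trans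
      (hdiag L hL V p hp m n hm hn hnm y)
  have hfar (m : ℕ) (hm : m ≤ n) :
      ∑ y with 2 * (1 + d / α) * ρ ≤ |rep y i|, convPow (truncate p ρ) m y ≤
        B * (n * V ^ α / ρ ^ α) ^ (1 + d / α) := by
    refine htail L V p hp ρ hρ hρL _ ht m ?_ _ i
    rw [div_mul_cancel₀ _ (by positivity)]
    gcongr
  obtain ⟨j, k, hj, hk, hjk, hnj, hnk⟩ := exists_add_eq_le_three_mul hn₂
  calc convPow (truncate p ρ) n x = convPow (truncate p ρ) (j + k) x := by rw [hjk]
    _ ≤ 2 * (A * S) * (B * (n * V ^ α / ρ ^ α) ^ (1 + d / α)) :=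
        convPow_add_le_of_tail_le (h := fun y : Torus d L => |rep y i|) (truncate_nonneg hp₀)
          (fun y z => (abs_rep_add_apply_le y z i).trans (abs_add_le _ _)) (hsup j hj hnj)
          (hsup k hk hnk) (hfar j (by lia)) (hfar k (by lia)) (by linarith)
    _ = 2 * A * B * (S * (n * V ^ α / ρ ^ α) ^ (1 + d / α)) := by ring
    _ ≤ 2 * A * B * (n * V ^ α / ρ ^ ((d : ℝ) + α) + 1 / (L : ℝ) ^ d) := by
        gcongr
        exact rpow_neg_add_mul_le (by exact_mod_cast hd) hα₀ (by positivity) hρ hnρ (by positivity)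

theorem exists_convPow_le_of_radius (hd : 1 ≤ d) (hα : α ∈ Set.Ioo (0 : ℝ) 2) (hc₁ : 0 < c₁)
    (hc₂ : 0 < c₂) :
    ∃ C : ℝ, 0 < C ∧ ∀ (L : ℕ) [NeZero L], 2 ≤ L → ∀ (V : ℝ) (p : Torus d L → ℝ),
      IsStableKernel p α V c₁ c₂ → ∀ n : ℕ, 1 ≤ n → ∀ (x : Torus d L) (ρ : ℝ),
        ρ = max (torusNorm x) V / (√d * (4 * (1 + d / α))) →
          convPow p n x ≤ C * (n * V ^ α / ρ ^ ((d : ℝ) + α) + 1 / (L : ℝ) ^ d) := by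
  have hα₀ := hα.1
  obtain ⟨A, hA, hdiag⟩ := exists_convPow_le hd hα₀ hc₁ hc₂
  obtain ⟨B, hB, hshort⟩ := exists_convPow_truncate_le hd hα hc₁ hc₂
  have : 0 < √(d : ℝ) := Real.sqrt_pos.2 (by exact_mod_cast hd)
  have hθ : 1 ≤ 4 * (1 + d / α) := by linarith [show 0 ≤ d / α by positivity]
  refine ⟨A + (B + c₂), by positivity, fun L _ hL V p hp n hn x ρ hρ => ?_⟩
  have hV := hp.scale_pos
  have hp₀ := hp.mem_stdSimplex.1
  have hn₁ : (1 : ℝ) ≤ n := by exact_mod_cast hn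
  have hρ_pos : 0 < ρ := hρ ▸ div_pos (lt_max_of_lt_right hV) (by positivity)
  set X : ℝ := n * V ^ α / ρ ^ ((d : ℝ) + α)
  rw [add_mul A]
  rcases le_or_gt (ρ ^ α) (n * V ^ α) with hnear | hfar
  · refine (hdiag L hL V p hp n hn x).trans (le_add_of_le_of_nonneg ?_ (by positivity))
    gcongr
    exact rpow_neg_le_div_rpow d.cast_nonneg hα₀ hρ_pos hnear
  · refine le_add_of_nonneg_of_le (by positivity) ?_
    have hVρ : V < ρ := by
      refine (Real.rpow_lt_rpow_iff hV.le hρ_pos.le hα₀).1 (lt_of_le_of_lt ?_ hfar)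
      exact le_mul_of_one_le_left (by positivity) hn₁
    obtain ⟨i, hi⟩ : ∃ i, 4 * (1 + d / α) * ρ ≤ |rep x i| :=
      hρ ▸ exists_mul_le_abs_rep hd hθ (hρ ▸ hVρ)
    calc convPow p n x
        ≤ convPow (truncate p ρ) n x + n * (c₂ * (V ^ α / ρ ^ ((d : ℝ) + α))) :=
          convPow_le_add_of_le_add (truncate_nonneg hp₀) (truncate_le hp₀) hp.mem_stdSimplex
            (by positivity) (hp.le_truncate_add hα₀ hc₂.le hρ_pos) n x
      _ ≤ B * (X + 1 / (L : ℝ) ^ d) + c₂ * X :=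
          add_le_add (hshort L hL V p hp ρ hρ_pos n hn hfar.le x i hi) (le_of_eq (by ring))
      _ ≤ (B + c₂) * (X + 1 / (L : ℝ) ^ d) := by
          rw [add_mul]
          gcongr
          exact le_add_of_nonneg_right (by positivity)

theorem exists_convPow_le_mul_stableProfile (hd : 1 ≤ d) (hα : α ∈ Set.Ioo (0 : ℝ) 2)
    (hc₁ : 0 < c₁) (hc₂ : 0 < c₂) :
    ∃ C : ℝ, 0 < C ∧ ∀ (L : ℕ) [NeZero L], 2 ≤ L → ∀ (V : ℝ) (p : Torus d L → ℝ),
      IsStableKernel p α V c₁ c₂ → ∀ n : ℕ, 1 ≤ n → ∀ x,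
        convPow p n x ≤ C * (n * stableProfile α V x + 1 / (L : ℝ) ^ d) := by
  have hα₀ := hα.1
  obtain ⟨C, hC, hbound⟩ := exists_convPow_le_of_radius hd hα hc₁ hc₂
  have hsqrt : 1 ≤ √(d : ℝ) := Real.one_le_sqrt.2 (by exact_mod_cast hd)
  have hθ : 1 ≤ 4 * (1 + d / α) := by linarith [show 0 ≤ d / α by positivity]
  set κ : ℝ := √d * (4 * (1 + d / α))
  have hκ : 1 ≤ κ := one_le_mul_of_one_le_of_one_le hsqrt hθ
  refine ⟨C * κ ^ ((d : ℝ) + α), by positivity, fun L _ hL V p hp n hn x => ?_⟩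
  have hm : 0 < max (torusNorm x) V := lt_max_of_lt_right hp.scale_pos
  have hrescale : n * V ^ α / (max (torusNorm x) V / κ) ^ ((d : ℝ) + α) =
      κ ^ ((d : ℝ) + α) * (n * stableProfile α V x) := by
    rw [stableProfile, Real.div_rpow hm.le (by positivity)]
    field_simp
  refine (hbound L hL V p hp n hn x _ rfl).trans ?_
  rw [hrescale, mul_assoc, mul_add (κ ^ ((d : ℝ) + α))]
  gcongr
  exact le_mul_of_one_le_left (by positivity) (Real.one_le_rpow hκ (by positivity))

end OffDiagonal

section Walk

variable {d L : ℕ} [NeZero L] {α V W : ℝ} {f : EuclideanSpace ℝ (Fin d) → ℝ}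

/-- The law `p_1(0, ·)` of one step of the circulant walk with profile `f` and bandwidth `W`. -/
noncomputable def stepLaw (L : ℕ) [NeZero L] (W : ℝ) (f : EuclideanSpace ℝ (Fin d) → ℝ)
    (x : Torus d L) : ℝ :=
  if x = 0 then 0 else f (W⁻¹ • rep x) / Omega L W f

theorem transition_pow_apply (n : ℕ) (x y : Torus d L) :
    (transition L W f ^ n) x y = convPow (stepLaw L W f) n (y - x) := by
  have htranspose :
      transition L W f = (Matrix.circulant (stepLaw L W f)).transpose := by
    ext x y
    simp only [transition, stepLaw, Matrix.of_apply, Matrix.transpose_apply,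
      Matrix.circulant_apply, sub_eq_zero, eq_comm]
  rw [htranspose, ← Matrix.transpose_pow, Matrix.transpose_apply, circulant_pow,
    Matrix.circulant_apply]

theorem stepProb_eq_convPow (n : ℕ) (x : Torus d L) :
    stepProb L W f n x = convPow (stepLaw L W f) n x := by
  rw [stepProb, transition_pow_apply, sub_zero]

theorem sum_stepLaw (hΩ : Omega L W f ≠ 0) : ∑ x, stepLaw L W f x = 1 := by
  simp only [stepLaw, ← ite_not (_ = (0 : Torus d L))]
  rw [← sum_filter, ← sum_div, ← Omega, div_self hΩ]

theorem stepLaw_neg (hf : ∀ x, f (-x) = f x) {x : Torus d L} (hx : rep (-x) = -rep x) :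
    stepLaw L W f (-x) = stepLaw L W f x := by
  simp only [stepLaw, neg_eq_zero, hx, smul_neg, hf]

-- Beyond the side `L` a larger bandwidth no longer matters: both profiles are then bounded above
-- and below, which is why the scale of the walk is `min W L`.
theorem exists_profile_comparable (hd : 1 ≤ d) (hα : 0 < α)
    (hf : Comparable f fun x => max ‖x‖ 1 ^ (-(d : ℝ) - α)) :
    ∃ b₁ b₂ : ℝ, 0 < b₁ ∧ 0 < b₂ ∧ ∀ (L : ℕ) [NeZero L] (W : ℝ), 0 < W → ∀ x : Torus d L,
      b₁ * (min W L ^ d * stableProfile α (min W L) x) ≤ f (W⁻¹ • rep x) ∧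
      f (W⁻¹ • rep x) ≤ b₂ * (min W L ^ d * stableProfile α (min W L) x) := by
  obtain ⟨C₁, C₂, hC₁, hC₂, hC⟩ := hf
  have hsqrt : 1 ≤ √(d : ℝ) := Real.one_le_sqrt.2 (by exact_mod_cast hd)
  have hD : 1 ≤ √d ^ ((d : ℝ) + α) := Real.one_le_rpow hsqrt (by positivity)
  refine ⟨C₁, C₂ * √d ^ ((d : ℝ) + α), hC₁, by positivity, fun L _ W hW x => ?_⟩
  have hL : (0 : ℝ) < L := Nat.cast_pos.2 (NeZero.pos L)
  have hfx := hC (W⁻¹ • rep x)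
  simp only [max_norm_inv_smul_rep_rpow hW] at hfx
  refine ⟨hfx.1.trans' ?_, hfx.2.trans ?_⟩
  · gcongr C₁ * ?_
    exact pow_mul_stableProfile_le hα (lt_min hW hL) (min_le_left _ _) x
  · rw [mul_assoc]
    gcongr C₂ * ?_
    rcases le_total W L with hWL | hLW
    · rw [min_eq_left hWL]
      exact le_mul_of_one_le_left (by have := stableProfile_pos hW α x; positivity) hD
    · rw [min_eq_right hLW]
      exact (pow_mul_stableProfile_le_one hα hW x).trans
        (one_le_sqrt_rpow_mul_pow_mul_stableProfile_side hd hα x)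

theorem isStableKernel_stepLaw (hf : ∀ x, f (-x) = f x) {b₁ b₂ k K s : ℝ} (hb₁ : 0 < b₁)
    (hb₂ : 0 < b₂) (hk : 0 < k) (hK : 0 < K) (hs : 0 < s) (hV : 0 < V)
    (hprofile : ∀ x : Torus d L, b₁ * (s * stableProfile α V x) ≤ f (W⁻¹ • rep x) ∧
      f (W⁻¹ • rep x) ≤ b₂ * (s * stableProfile α V x))
    (hΩ_ge : b₁ * (s * k) ≤ Omega L W f) (hΩ_le : Omega L W f ≤ b₂ * (s * K)) :
    IsStableKernel (stepLaw L W f) α V (b₁ / (b₂ * K)) (b₂ / (b₁ * k)) := by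
  have hpos (x : Torus d L) : 0 < stableProfile α V x := stableProfile_pos hV α x
  have hΩ : 0 < Omega L W f := hΩ_ge.trans_lt' (by positivity)
  have hquot (x : Torus d L) : 0 ≤ f (W⁻¹ • rep x) / Omega L W f := by
    have := hpos x
    exact div_nonneg ((hprofile x).1.trans' (by positivity)) hΩ.le
  refine ⟨hV, ⟨fun x => ite_nonneg le_rfl (hquot x), sum_stepLaw hΩ.ne'⟩, fun x hx => ?_,
    fun x => ?_, fun x hx => stepLaw_neg hf hx⟩
  · have := hpos x
    calc b₁ / (b₂ * K) * stableProfile α V x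
        = b₁ * (s * stableProfile α V x) / (b₂ * (s * K)) := by field_simp
      _ ≤ f (W⁻¹ • rep x) / Omega L W f :=
        div_le_div₀ ((hprofile x).1.trans' (by positivity)) (hprofile x).1 hΩ hΩ_le
      _ = stepLaw L W f x := (if_neg hx).symm
  · have := hpos x
    calc stepLaw L W f x ≤ f (W⁻¹ • rep x) / Omega L W f := by
          unfold stepLaw
          split_ifs
          exacts [hquot x, le_rfl]
      _ ≤ b₂ * (s * stableProfile α V x) / (b₁ * (s * k)) :=
        div_le_div₀ (by positivity) (hprofile x).2 (by positivity) hΩ_ge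
      _ = b₂ / (b₁ * k) * stableProfile α V x := by field_simp

theorem exists_isStableKernel_stepLaw (hd : 1 ≤ d) (hα : 0 < α) (hf : ∀ x, f (-x) = f x)
    (hfα : Comparable f fun x => max ‖x‖ 1 ^ (-(d : ℝ) - α)) {W₀ : ℝ} (hW₀ : 0 < W₀) :
    ∃ c₁ c₂ : ℝ, 0 < c₁ ∧ 0 < c₂ ∧ ∀ (L : ℕ) [NeZero L], 2 ≤ L → ∀ W : ℝ, W₀ ≤ W →
      IsStableKernel (stepLaw L W f) α (min W L) c₁ c₂ := by
  obtain ⟨b₁, b₂, hb₁, hb₂, hprofile⟩ := exists_profile_comparable hd hα hfα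
  obtain ⟨k, hk, hle⟩ := exists_le_sum_stableProfile hd hα (lt_min hW₀ two_pos)
  obtain ⟨K, hK, hge⟩ := exists_sum_stableProfile_le d hα
  refine ⟨b₁ / (b₂ * K), b₂ / (b₁ * k), by positivity, by positivity, fun L _ hL W hW => ?_⟩
  have hL₂ : (2 : ℝ) ≤ L := by exact_mod_cast hL
  have hV₀ : min W₀ 2 ≤ min W L := min_le_min hW hL₂
  have hV : 0 < min W (L : ℝ) := (lt_min hW₀ two_pos).trans_le hV₀
  have hprofile_W := hprofile L W (hW₀.trans_le hW)
  refine isStableKernel_stepLaw hf hb₁ hb₂ hk hK (pow_pos hV d) hV hprofile_W ?_ ?_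
  · calc b₁ * (min W (L : ℝ) ^ d * k)
        ≤ b₁ * (min W (L : ℝ) ^ d *
            ∑ x : Torus d L with x ≠ 0, stableProfile α (min W L) x) := by
          gcongr
          exact hle L _ hL hV₀ (min_le_right _ _)
      _ ≤ Omega L W f := by
          rw [mul_sum, mul_sum]
          exact sum_le_sum fun x _ => (hprofile_W x).1
  · calc Omega L W f
        ≤ b₂ * (min W (L : ℝ) ^ d *
            ∑ x : Torus d L with x ≠ 0, stableProfile α (min W L) x) := by
          rw [mul_sum, mul_sum]
          exact sum_le_sum fun x _ => (hprofile_W x).2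
      _ ≤ b₂ * (min W (L : ℝ) ^ d * K) := by
          gcongr
          exact hge L _ hV

end Walk

section HeatKernel

variable {d : ℕ} {α c₁ c₂ : ℝ}

theorem mul_rpow_rpow_neg_div (hα : 0 < α) {n V : ℝ} (hn : 0 ≤ n) (hV : 0 ≤ V) :
    (n * V ^ α) ^ (-((d : ℝ) / α)) = 1 / (n ^ ((d : ℝ) / α) * V ^ d) := by
  rw [Real.rpow_neg (by positivity), Real.mul_rpow hn (by positivity), ← Real.rpow_mul hV,
    mul_div_cancel₀ _ hα.ne', Real.rpow_natCast, one_div]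

theorem exists_convPow_le_min (hd : 1 ≤ d) (hα : α ∈ Set.Ioo (0 : ℝ) 2) (hc₁ : 0 < c₁)
    (hc₂ : 0 < c₂) :
    ∃ C : ℝ, 0 < C ∧ ∀ (L : ℕ) [NeZero L], 2 ≤ L → ∀ (V : ℝ) (p : Torus d L → ℝ),
      IsStableKernel p α V c₁ c₂ → ∀ n : ℕ, 1 ≤ n → ∀ x, convPow p n x ≤
        C * (min (1 / ((n : ℝ) ^ ((d : ℝ) / α) * V ^ d)) (n * stableProfile α V x) +
          1 / (L : ℝ) ^ d) := by
  obtain ⟨A, hA, hdiag⟩ := exists_convPow_le hd hα.1 hc₁ hc₂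
  obtain ⟨B, -, hoff⟩ := exists_convPow_le_mul_stableProfile hd hα hc₁ hc₂
  refine ⟨max A B, lt_max_of_lt_left hA, fun L _ hL V p hp n hn x => ?_⟩
  have hV := hp.scale_pos
  have := stableProfile_pos hV α x
  rw [min_add, mul_min_of_nonneg _ _ (by positivity), ← mul_rpow_rpow_neg_div hα.1 n.cast_nonneg
    hV.le]
  refine le_min ((hdiag L hL V p hp n hn x).trans ?_) ((hoff L hL V p hp n hn x).trans ?_)
  · gcongr
    exact le_max_left A B
  · gcongr
    exact le_max_right A B

end HeatKernel

end CirculantWalk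

open CirculantWalk

theorem mainTheorem2_general (d : ℕ) (hd : 1 ≤ d) (α : ℝ) (hα : α ∈ Set.Ioo (0 : ℝ) 2)
    (f : EuclideanSpace ℝ (Fin d) → ℝ) (hf : ∀ x, f (-x) = f x)
    (hfα : Comparable f fun x => max ‖x‖ 1 ^ (-(d : ℝ) - α)) (W₀ : ℝ) (hW₀ : 0 < W₀) :
    ∃ C : ℝ, 0 < C ∧
      ∀ (L : ℕ) [NeZero L], 2 ≤ L → ∀ W : ℝ, W₀ ≤ W → ∀ n : ℕ, 1 ≤ n → ∀ x : Torus d L,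
        stepProb L W f n x ≤
          C * (min (1 / ((n : ℝ) ^ ((d : ℝ) / α) * W ^ d))
                ((n : ℝ) * W ^ α / max (torusNorm x) W ^ ((d : ℝ) + α)) + 1 / (L : ℝ) ^ d) := by
  obtain ⟨c₁, c₂, hc₁, hc₂, hstep⟩ := exists_isStableKernel_stepLaw hd hα.1 hf hfα hW₀
  obtain ⟨C, hC, hbound⟩ := exists_convPow_le_min hd hα hc₁ hc₂
  refine ⟨2 * C, by positivity, fun L _ hL W hW n hn x => ?_⟩
  have hW_pos : 0 < W := hW₀.trans_le hW
  have : 0 < max (torusNorm x) W := lt_max_of_lt_right hW_pos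
  have hmin : 0 ≤ min (1 / ((n : ℝ) ^ ((d : ℝ) / α) * W ^ d))
      ((n : ℝ) * W ^ α / max (torusNorm x) W ^ ((d : ℝ) + α)) :=
    le_min (by positivity) (by positivity)
  have hN : 0 < 1 / (L : ℝ) ^ d := by positivity
  have hkernel := hbound L hL _ _ (hstep L hL W hW) n hn x
  rw [stepProb_eq_convPow, mul_assoc, two_mul, ← mul_add]
  refine hkernel.trans (mul_le_mul_of_nonneg_left ?_ hC.le)
  rcases le_total W L with hWL | hLW
  · rw [min_eq_left hWL, stableProfile, ← mul_div_assoc]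
    linarith
  · have hspread : 1 / ((n : ℝ) ^ ((d : ℝ) / α) * min W (L : ℝ) ^ d) ≤ 1 / (L : ℝ) ^ d := by
      rw [min_eq_right hLW]
      have : (0 : ℝ) < L := Nat.cast_pos.2 (NeZero.pos L)
      gcongr
      exact le_mul_of_one_le_left (by positivity)
        (Real.one_le_rpow (by exact_mod_cast hn) (by have := hα.1; positivity))
    linarith [min_le_left (1 / ((n : ℝ) ^ ((d : ℝ) / α) * min W (L : ℝ) ^ d))
      (n * stableProfile α (min W (L : ℝ)) x)]

theorem mainTheorem2 (d : ℕ) (hd : 1 ≤ d) (α : ℝ) (hα : α ∈ Set.Ioo (0 : ℝ) 2)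
    (f : EuclideanSpace ℝ (Fin d) → ℝ) (hf : CirculantWalk.IsSymmetricDensity f)
    (hfα : CirculantWalk.Comparable f fun x => (max ‖x‖ 1) ^ (-(d : ℝ) - α))
    (W₀ : ℝ) (hW₀ : 0 < W₀) :
    ∃ C : ℝ, 0 < C ∧
      ∀ (L : ℕ) [NeZero L], 2 ≤ L → ∀ W : ℝ, W₀ ≤ W → ∀ n : ℕ, 1 ≤ n →
        ∀ x : CirculantWalk.Torus d L,
          CirculantWalk.stepProb L W f n x ≤
            C * (min (1 / ((n : ℝ) ^ ((d : ℝ) / α) * W ^ d))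
                  ((n : ℝ) * W ^ α / (max (CirculantWalk.torusNorm x) W) ^ ((d : ℝ) + α))
                + 1 / (L : ℝ) ^ d) :=
  mainTheorem2_general d hd α hα f hf.symm hfα W₀ hW₀
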